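/- Let $\bar A\in\{0,\star\}^{n\times n}$ and $\bar B\in\{0,\star\}^{n\times p}$ be structural matrices ($\star$ = free real parameter). For $\mathcal J\subseteq\{1,\dots,p\}$ let $\bar B_{\mathcal J}$ be the submatrix of the columns of $\bar B$ with index in $\mathcal J$. The pair $(\bar A,\bar B_{\mathcal J})$ is structurally controllable if there are real matrices $A,B$, of the same sizes and vanishing wherever $\bar A,\bar B_{\mathcal J}$ have a $0$, such that the system $\dot x=Ax+Bu$ is controllable. The minimum constrained input selection problem (minCIS) asks for a set $\mathcal J$ of minimum cardinality such that $(\bar A,\bar B_{\mathcal J})$ is structurally controllable. The state digraph $\mathcal D(\bar A)$ has vertices $x_1,\dots,x_n$ and an edge $(x_i,x_j)$ whenever $\bar A_{j,i}=\star$; a strongly connected component (SCC) of it is non-top-linked if no edge enters it from a vertex of another SCC. The state bipartite graph has two copies of $\{x_1,\dots,x_n\}$ as its sides, the left copy of $x_i$ being joined to the right copy of $x_j$ whenever $(x_i,x_j)$ is an edge of $\mathcal D(\bar A)$. Theorem. Assume that the state bipartite graph of $\bar A$ has a perfect matching. Let $\mathcal N^1,\dots,\mathcal N^k$ be the non-top-linked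 SCCs of $\mathcal D(\bar A)$, and put $\mathcal U=\{1,\dots,k\}$ and, for $j=1,\dots,p$, $$\mathcal S_j=\{i\in\mathcal U:\ \bar B_{r,j}=\star\text{ for some } x_r\in\mathcal N^i\}.$$ Then minCIS for $(\bar A,\bar B)$ reduces in polynomial time to the minimum set covering problem with universe $\mathcal U$ and sets $\mathcal S_1,\dots,\mathcal S_p$. That is: (1) there are one program for a random access machine (unit cost; arithmetic limited to addition and truncated subtraction of natural numbers) and one polynomial $q$ such that, on every input $(\bar A,\bar B)$ as above, the program halts after at most $q(n+p)$ steps and outputs the set covering instance $(\mathcal U,\{\mathcal S_j\}_{j=1,\dots,p})$, for some enumeration of the non-top-linked SCCs; (2) for every enumeration of the non-top-linked SCCs and every $\mathcal J\subseteq\{1,\dots,p\}$, the pair $(\bar A,\bar B_{\mathcal J})$ is structurally controllable if and only if $\bigcup_{j\in\mathcal J}\mathcal S_j=\mathcal U$; and $\mathcal J$ is a solution of minCIS if and only if it is a solution of the minimum set covering problem, i.e. a set of indices of minimum cardinality whose $\mathcal S_j$ cover $\mathcal U$. -/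

import Mathlib

/-! ## Structural matrices and structural controllability -/

/-- The system `x' = A x + B u` is controllable: every state can be steered to every state in some
finite time by some continuous input. -/
def Controllable {n : ℕ} {ι : Type*} [Fintype ι]
    (A : Matrix (Fin n) (Fin n) ℝ) (B : Matrix (Fin n) ι ℝ) : Prop :=
  ∀ x₀ x₁ : Fin n → ℝ, ∃ T : ℝ, 0 < T ∧ ∃ (u : ℝ → ι → ℝ) (x : ℝ → Fin n → ℝ),
    Continuous u ∧ x 0 = x₀ ∧ x T = x₁ ∧
    ∀ t ∈ Set.Icc 0 T, HasDerivAt x (A.mulVec (x t) + B.mulVec (u t)) t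

/-- A structural matrix, with entries in `{0, ⋆}`; `true` stands for `⋆` and `false` for `0`. -/
abbrev StructMatrix (m n : Type*) := Matrix m n Bool

/-- The real matrix `M` is a numerical realization of the structural matrix `P`: it vanishes
wherever `P` has a `0` (a `⋆` is a free real parameter). -/
def IsRealization {m n : Type*} (P : StructMatrix m n) (M : Matrix m n ℝ) : Prop :=
  ∀ i j, P i j = false → M i j = 0

/-- Structural controllability of a pair of structural matrices. -/
def StructurallyControllable {n : ℕ} {ι : Type*} [Fintype ι]
    (A : StructMatrix (Fin n) (Fin n)) (B : StructMatrix (Fin n) ι) : Prop :=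
  ∃ (A' : Matrix (Fin n) (Fin n) ℝ) (B' : Matrix (Fin n) ι ℝ),
    IsRealization A A' ∧ IsRealization B B' ∧ Controllable A' B'

/-- The columns of `B` with index in `J`. -/
def selectColumns {n p : ℕ} (B : StructMatrix (Fin n) (Fin p)) (J : Finset (Fin p)) :
    StructMatrix (Fin n) {j // j ∈ J} :=
  B.submatrix id Subtype.val

/-- `J` is a feasible input selection: `(A, B_J)` is structurally controllable. -/
def IsInputSelection {n p : ℕ} (A : StructMatrix (Fin n) (Fin n))
    (B : StructMatrix (Fin n) (Fin p)) (J : Finset (Fin p)) : Prop :=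
  StructurallyControllable A (selectColumns B J)

/-- `J` solves the minimum constrained input selection problem (minCIS) for `(A, B)`. -/
def IsMinInputSelection {n p : ℕ} (A : StructMatrix (Fin n) (Fin n))
    (B : StructMatrix (Fin n) (Fin p)) (J : Finset (Fin p)) : Prop :=
  IsInputSelection A B J ∧ ∀ J' : Finset (Fin p), IsInputSelection A B J' → J.card ≤ J'.card

/-! ## The state digraph and the state bipartite graph -/

/-- The state digraph: there is an edge from `x_i` to `x_j` when `A_{j,i}` is `⋆`. -/
def stateDigraph {n : ℕ} (A : StructMatrix (Fin n) (Fin n)) : Digraph (Fin n) where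
  Adj i j := A j i = true

/-- There is a directed path (possibly of length zero) from `u` to `v`. -/
def Digraph.HasPath {V : Type*} (D : Digraph V) (u v : V) : Prop :=
  Relation.ReflTransGen D.Adj u v

/-- `S` is the vertex set of a strongly connected component of `D`. -/
def Digraph.IsSCC {V : Type*} (D : Digraph V) (S : Set V) : Prop :=
  Maximal (fun S' : Set V => S'.Nonempty ∧ ∀ u ∈ S', ∀ v ∈ S', D.HasPath u v) S

/-- `S` is a non-top-linked strongly connected component of `D`: no edge enters it from a vertex
of another component. -/
def Digraph.IsNonTopLinkedSCC {V : Type*} (D : Digraph V) (S : Set V) : Prop :=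
  D.IsSCC S ∧ ∀ S' : Set V, D.IsSCC S' → S' ≠ S → ∀ u ∈ S', ∀ v ∈ S, ¬ D.Adj u v

/-- The type of the non-top-linked strongly connected components of the state digraph of `A`. -/
abbrev NonTopLinkedSCC {n : ℕ} (A : StructMatrix (Fin n) (Fin n)) : Type :=
  {S : Set (Fin n) // (stateDigraph A).IsNonTopLinkedSCC S}

/-- The state bipartite graph: two copies of the set of states (left: `Sum.inl`, right: `Sum.inr`),
the left copy of `u` being joined to the right copy of `v` when `(u, v)` is an edge of the state
digraph. -/
def stateBipartiteGraph {n : ℕ} (A : StructMatrix (Fin n) (Fin n)) :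
    SimpleGraph (Fin n ⊕ Fin n) where
  Adj a b :=
    (∃ u v, a = Sum.inl u ∧ b = Sum.inr v ∧ (stateDigraph A).Adj u v) ∨
    (∃ u v, b = Sum.inl u ∧ a = Sum.inr v ∧ (stateDigraph A).Adj u v)
  symm := ⟨fun _ _ h => h.symm⟩
  loopless := ⟨by
    rintro a (⟨u, v, h₁, h₂, -⟩ | ⟨u, v, h₁, h₂, -⟩) <;> subst h₁ <;> cases h₂⟩

/-- The state bipartite graph of `A` has a perfect matching. -/
def HasPerfectStateMatching {n : ℕ} (A : StructMatrix (Fin n) (Fin n)) : Prop :=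
  ∃ M : (stateBipartiteGraph A).Subgraph, M.IsPerfectMatching

/-! ## Minimum set covering -/

/-- The sets with index in `J` cover the universe `Fin k`. -/
def IsSetCover {k p : ℕ} (S : Fin p → Set (Fin k)) (J : Finset (Fin p)) : Prop :=
  ⋃ j ∈ J, S j = Set.univ

/-- `J` solves the minimum set covering problem for the family `S` of subsets of `Fin k`. -/
def IsMinSetCover {k p : ℕ} (S : Fin p → Set (Fin k)) (J : Finset (Fin p)) : Prop :=
  IsSetCover S J ∧ ∀ J' : Finset (Fin p), IsSetCover S J' → J.card ≤ J'.card

/-- The set attached to the input `j`, given an enumeration `N` of the non-top-linked SCCs: the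
indices of those that contain a state actuated by the input `j`. -/
def coverSet {n p k : ℕ} (A : StructMatrix (Fin n) (Fin n)) (B : StructMatrix (Fin n) (Fin p))
    (N : Fin k ≃ NonTopLinkedSCC A) (j : Fin p) : Set (Fin k) :=
  {i | ∃ r : Fin n, B r j = true ∧ r ∈ (N i).val}

/-! ## A random access machine with a step count

Programs are structured, mention finitely many registers and finitely many arrays, both holding
natural numbers, and every elementary instruction and every test costs one step. Arithmetic is
limited to constants, addition and truncated subtraction (there is no multiplication), so that
polynomial time on this machine is polynomial time on Turing machines. -/

namespace RAM

/-- A memory configuration: the contents of the registers and of the arrays. -/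
structure Store where
  reg : ℕ → ℕ
  arr : ℕ → ℕ → ℕ

/-- Assign the value `v` to the register `x`. -/
def Store.setReg (s : Store) (x v : ℕ) : Store :=
  { s with reg := Function.update s.reg x v }

/-- Assign the value `v` to the cell `i` of the array `a`. -/
def Store.setArr (s : Store) (a i v : ℕ) : Store :=
  { s with arr := Function.update s.arr a (Function.update (s.arr a) i v) }

/-- Programs. Here `x y z` are names of registers and `a` is the name of an array. -/
inductive Program : Type
  /-- do nothing -/
  | skip : Program
  /-- `x := c` -/
  | const (x c : ℕ) : Program
  /-- `x := y + z` -/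
  | add (x y z : ℕ) : Program
  /-- `x := y - z` (truncated at `0`) -/
  | sub (x y z : ℕ) : Program
  /-- `x := a[y]` -/
  | load (x a y : ℕ) : Program
  /-- `a[y] := x` -/
  | store (a y x : ℕ) : Program
  /-- first `c`, then `d` -/
  | seq (c d : Program) : Program
  /-- if `x ≠ 0` then `c` else `d` -/
  | branch (x : ℕ) (c d : Program) : Program
  /-- while `x ≠ 0` do `c` -/
  | loop (x : ℕ) (c : Program) : Program

/-- `Runs c s t s'`: started on the store `s`, the program `c` halts after exactly `t` steps, with
the store `s'`. -/
inductive Runs : Program → Store → ℕ → Store → Prop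
  | skip (s : Store) : Runs .skip s 1 s
  | const (s : Store) (x c : ℕ) : Runs (.const x c) s 1 (s.setReg x c)
  | add (s : Store) (x y z : ℕ) : Runs (.add x y z) s 1 (s.setReg x (s.reg y + s.reg z))
  | sub (s : Store) (x y z : ℕ) : Runs (.sub x y z) s 1 (s.setReg x (s.reg y - s.reg z))
  | load (s : Store) (x a y : ℕ) : Runs (.load x a y) s 1 (s.setReg x (s.arr a (s.reg y)))
  | store (s : Store) (a y x : ℕ) : Runs (.store a y x) s 1 (s.setArr a (s.reg y) (s.reg x))
  | seq {c d : Program} {s s' s'' : Store} {t t' : ℕ} :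
      Runs c s t s' → Runs d s' t' s'' → Runs (.seq c d) s (t + t') s''
  | branch_true {x : ℕ} {c d : Program} {s s' : Store} {t : ℕ} :
      s.reg x ≠ 0 → Runs c s t s' → Runs (.branch x c d) s (t + 1) s'
  | branch_false {x : ℕ} {c d : Program} {s s' : Store} {t : ℕ} :
      s.reg x = 0 → Runs d s t s' → Runs (.branch x c d) s (t + 1) s'
  | loop_true {x : ℕ} {c : Program} {s s' s'' : Store} {t t' : ℕ} :
      s.reg x ≠ 0 → Runs c s t s' → Runs (.loop x c) s' t' s'' →
      Runs (.loop x c) s (t + t' + 1) s''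
  | loop_false {x : ℕ} {c : Program} {s : Store} :
      s.reg x = 0 → Runs (.loop x c) s 1 s

/-- The machine is deterministic. -/
theorem Runs.deterministic {c : Program} {s s₁ s₂ : Store} {t₁ t₂ : ℕ}
    (h₁ : Runs c s t₁ s₁) (h₂ : Runs c s t₂ s₂) : t₁ = t₂ ∧ s₁ = s₂ := by
  induction h₁ generalizing t₂ s₂ with
  | seq _ _ ih ih' =>
    cases h₂ with
    | seq h h' =>
      obtain ⟨rfl, rfl⟩ := ih h
      obtain ⟨rfl, rfl⟩ := ih' h'
      exact ⟨rfl, rfl⟩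
  | branch_true hx _ ih =>
    cases h₂ with
    | branch_true _ h => obtain ⟨rfl, rfl⟩ := ih h; exact ⟨rfl, rfl⟩
    | branch_false hx' _ => exact absurd hx' hx
  | branch_false hx _ ih =>
    cases h₂ with
    | branch_true hx' _ => exact absurd hx hx'
    | branch_false _ h => obtain ⟨rfl, rfl⟩ := ih h; exact ⟨rfl, rfl⟩
  | loop_true hx _ _ ih ih' =>
    cases h₂ with
    | loop_true _ h h' =>
      obtain ⟨rfl, rfl⟩ := ih h
      obtain ⟨rfl, rfl⟩ := ih' h'
      exact ⟨rfl, rfl⟩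
    | loop_false hx' => exact absurd hx' hx
  | loop_false hx =>
    cases h₂ with
    | loop_true hx' _ _ => exact absurd hx hx'
    | loop_false _ => exact ⟨rfl, rfl⟩
  | _ => cases h₂; exact ⟨rfl, rfl⟩

end RAM

open Classical in
/-- A structural matrix with `p` columns, written row by row (`⋆` as `1`, and `0` as `0`). -/
noncomputable def rowMajor {m p : ℕ} (M : StructMatrix (Fin m) (Fin p)) (a : ℕ) : ℕ :=
  if ∃ (i : Fin m) (j : Fin p), a = (i : ℕ) * p + (j : ℕ) ∧ M i j = true then 1 else 0

/-- The machine's initial store on the minCIS instance `(A, B)`: `n` and `p` in the registers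
`0` and `1`, the matrices in the arrays `0` and `1`, and `0` everywhere else. -/
noncomputable def minCISInput {n p : ℕ} (A : StructMatrix (Fin n) (Fin n)) (B : StructMatrix (Fin n) (Fin p)) :
    RAM.Store where
  reg x := if x = 0 then n else if x = 1 then p else 0
  arr a := if a = 0 then rowMajor A else if a = 1 then rowMajor B else fun _ => 0

/-- The store `s` holds, as an output, the set covering instance with universe `Fin k` and sets
`S j`, `j : Fin p`: `k` and `p` in the registers `0` and `1`, and the `k × p` incidence matrix, row
by row, in the array `2`. -/
def HoldsSetCoverInstance (s : RAM.Store) {k p : ℕ} (S : Fin p → Set (Fin k)) : Prop :=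
  s.reg 0 = k ∧ s.reg 1 = p ∧
  ∀ (i : Fin k) (j : Fin p),
    (i ∈ S j → s.arr 2 ((i : ℕ) * p + (j : ℕ)) = 1) ∧
    (i ∉ S j → s.arr 2 ((i : ℕ) * p + (j : ℕ)) = 0)

/-!
The system `x' = A x + B u` fails to be controllable when some set of states is influenced neither
by other states nor by inputs (`not_controllable_of_autonomous`): by uniqueness of solutions these
states, started at zero, stay zero. For a non-top-linked component without an actuated state this is
so whatever the free parameters are, so that a feasible set of inputs gives a set cover.

Conversely, let every non-top-linked component contain an actuated state. Then every state is
reached from an actuated one, since every state has an ancestor in such a component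
(`Digraph.exists_isSource_hasPath`). The perfect matching is a permutation `σ` of the states along
edges (`HasPerfectStateMatching.exists_perm`). The realization consists of the cycles of `σ`, with
one weight per cycle and different weights for different cycles, and of a forest of edges that
connects each cycle to an actuated one (`CycleForest`). By the Popov-Belevitch-Hautus test
(`controllable_of_forall_left_eigenvector`) it is enough that no left eigenvector `w ≠ 0` is
orthogonal to the input columns. The eigenvalues belonging to a cycle have its weight as absolute
value, so an eigenvalue determines its cycle, and `w` is supported on the path of the forest from
that cycle up to a root. On this path `w` vanishes nowhere, in particular not at the input edge of
the root (`CycleForest.eigenvector_eq_zero`).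

The PBH test itself follows from the variation of constants formula
(`controllable_of_forall_integral_exp`): a linear functional that vanishes on all states reachable
from zero annihilates `exp (-s A) B` for `s ∈ [0, 1]`. Such functionals form a space invariant under
the transpose of `A`, and the complexification of that space, unless zero, contains an eigenvector.

The reduction (`RAM.reduction`) computes the reachability relation by Warshall's algorithm, and goes
through the states to find the leaders, that is, the least vertices of the non-top-linked
components. They are recognized by the property that all their ancestors are descendants and are not
smaller. The incidence row of such a component tells which inputs act on an ancestor of its leader.
As for time, each loop is iterated at most `n + p` times whenever it is executed, so that the
running time is bounded by a polynomial read off the program text (`RAM.Program.cost`).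
-/

/-! ### A sufficient test for controllability -/

theorem exp_smul_mul_exp_smul_neg {𝔸 : Type*} [NormedRing 𝔸] [NormedAlgebra ℝ 𝔸] [CompleteSpace 𝔸]
    (L : 𝔸) (t : ℝ) : NormedSpace.exp (t • L) * NormedSpace.exp (t • (-L)) = 1 := by
  let _ : NormedAlgebra ℚ 𝔸 := NormedAlgebra.restrictScalars ℚ ℝ 𝔸
  rw [← NormedSpace.exp_add_of_commute, ← smul_add, add_neg_cancel, smul_zero,
    NormedSpace.exp_zero]
  exact ((Commute.refl L).neg_right.smul_left t).smul_right t

/-- If no nonzero linear functional annihilates `exp (-s A) B` for all `s ∈ [0, 1]`, then every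
state is of the form `∫₀¹ exp (-s A) B u(s) ds`. A functional `f` vanishing on all these integrals
is seen to be zero by inserting the input `u(s) = (f (exp (-s A) B e_j))_j`, which turns the
integral into that of a sum of squares. -/
theorem exists_integral_exp_eq {n : ℕ} {ι : Type*} [Fintype ι]
    (L : (Fin n → ℝ) →L[ℝ] (Fin n → ℝ)) (B : Matrix (Fin n) ι ℝ)
    (h : ∀ f : (Fin n → ℝ) →L[ℝ] ℝ,
      (∀ s ∈ Set.Icc (0 : ℝ) 1, ∀ j, f (NormedSpace.exp (s • (-L)) (B.col j)) = 0) → f = 0)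
    (z : Fin n → ℝ) :
    ∃ u : ℝ → ι → ℝ, Continuous u ∧
      ∫ s in (0 : ℝ)..1, NormedSpace.exp (s • (-L)) (B.mulVec (u s)) = z := by
  have hE : Continuous fun s : ℝ => NormedSpace.exp (s • (-L)) :=
    continuous_iff_continuousAt.2 fun s => (hasDerivAt_exp_smul_const (-L) s).continuousAt
  have hcont : ∀ u : ℝ → ι → ℝ, Continuous u →
      Continuous fun s => NormedSpace.exp (s • (-L)) (B.mulVec (u s)) := fun u hu =>
    hE.clm_apply (continuous_const.matrix_mulVec hu)
  let R : Submodule ℝ (Fin n → ℝ) :=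
    { carrier := {z | ∃ u : ℝ → ι → ℝ, Continuous u ∧
        ∫ s in (0 : ℝ)..1, NormedSpace.exp (s • (-L)) (B.mulVec (u s)) = z}
      zero_mem' := ⟨fun _ => 0, continuous_const, by simp⟩
      add_mem' := by
        rintro _ _ ⟨u, hu, rfl⟩ ⟨v, hv, rfl⟩
        refine ⟨u + v, hu.add hv, ?_⟩
        rw [← intervalIntegral.integral_add ((hcont u hu).intervalIntegrable _ _)
          ((hcont v hv).intervalIntegrable _ _)]
        simp [Matrix.mulVec_add]
      smul_mem' := by
        rintro c _ ⟨u, hu, rfl⟩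
        refine ⟨c • u, hu.const_smul c, ?_⟩
        rw [← intervalIntegral.integral_smul]
        simp [Matrix.mulVec_smul] }
  suffices hR : R = ⊤ by
    have : z ∈ R := hR ▸ Submodule.mem_top
    exact this
  by_contra hR
  obtain ⟨f, hf0, hf⟩ := R.exists_le_ker_of_lt_top (lt_top_iff_ne_top.2 hR)
  let f' := LinearMap.toContinuousLinearMap f
  apply hf0
  suffices hf' : f' = 0 by
    ext x
    simpa [f'] using DFunLike.congr_fun hf' (Pi.single x 1)
  apply h
  set g : ℝ → ι → ℝ := fun s j => f' (NormedSpace.exp (s • (-L)) (B.col j)) with hg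
  have hgc : Continuous g :=
    continuous_pi fun j => f'.continuous.comp (hE.clm_apply continuous_const)
  have hint : ∫ s in (0 : ℝ)..1, ∑ j, g s j ^ 2 = 0 := by
    have h1 : f' (∫ s in (0 : ℝ)..1, NormedSpace.exp (s • (-L)) (B.mulVec (g s))) = 0 :=
      hf (show _ ∈ R from ⟨g, hgc, rfl⟩)
    rw [← ContinuousLinearMap.intervalIntegral_comp_comm _
      ((hcont g hgc).intervalIntegrable _ _)] at h1
    rw [← h1]
    congr 1
    ext s
    have : B.mulVec (g s) = ∑ j, g s j • B.col j := by
      ext i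
      simp [Matrix.mulVec, dotProduct, Matrix.col, mul_comm]
    rw [this, map_sum, map_sum]
    refine Finset.sum_congr rfl fun j _ => ?_
    rw [map_smul, map_smul, smul_eq_mul, pow_two]
  have hsq : Continuous fun s => ∑ j, g s j ^ 2 :=
    continuous_finsetSum _ fun j _ => ((continuous_apply j).comp hgc).pow 2
  rw [intervalIntegral.integral_eq_zero_iff_of_le_of_nonneg_ae zero_le_one
    (Filter.Eventually.of_forall fun s => Finset.sum_nonneg fun j _ => sq_nonneg _)
    (hsq.intervalIntegrable _ _),
    MeasureTheory.restrict_Ioc_eq_restrict_Icc] at hint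
  have hzero := MeasureTheory.Measure.eqOn_Icc_of_ae_eq _ zero_ne_one hint hsq.continuousOn
    continuousOn_const
  intro s hs j
  have := (Finset.sum_eq_zero_iff_of_nonneg (fun j _ => sq_nonneg (g s j))).1 (hzero hs) j
    (Finset.mem_univ j)
  exact pow_eq_zero_iff two_ne_zero |>.1 this

/-- Variation of constants: if all states are integrals `∫₀¹ exp (-s A) B u(s) ds`, then the system
can be steered between any two states in time `1`. -/
theorem controllable_of_forall_integral_exp {n : ℕ} {ι : Type*} [Fintype ι]
    (A : Matrix (Fin n) (Fin n) ℝ) (B : Matrix (Fin n) ι ℝ)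
    (h : ∀ z, ∃ u : ℝ → ι → ℝ, Continuous u ∧
      ∫ s in (0 : ℝ)..1, NormedSpace.exp (s • (-(LinearMap.toContinuousLinearMap A.mulVecLin)))
        (B.mulVec (u s)) = z) : Controllable A B := by
  set L := LinearMap.toContinuousLinearMap A.mulVecLin with hL
  intro x₀ x₁
  obtain ⟨u, hu, hz⟩ := h (NormedSpace.exp ((1 : ℝ) • (-L)) x₁ - x₀)
  refine ⟨1, one_pos, u, fun t => NormedSpace.exp (t • L)
    (x₀ + ∫ s in (0 : ℝ)..t, NormedSpace.exp (s • (-L)) (B.mulVec (u s))), hu, ?_, ?_, ?_⟩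
  · simp
  · simp only
    rw [hz, add_sub_cancel]
    exact DFunLike.congr_fun (exp_smul_mul_exp_smul_neg L 1) x₁
  · intro t _
    have hE : Continuous fun s : ℝ => NormedSpace.exp (s • (-L)) :=
      continuous_iff_continuousAt.2 fun s => (hasDerivAt_exp_smul_const (-L) s).continuousAt
    have hc : Continuous fun s => NormedSpace.exp (s • (-L)) (B.mulVec (u s)) :=
      hE.clm_apply (continuous_const.matrix_mulVec hu)
    refine ((hasDerivAt_exp_smul_const' L t).clm_apply
      ((hc.integral_hasStrictDerivAt 0 t).hasDerivAt.const_add x₀)).congr_deriv ?_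
    exact congrArg (_ + ·) (DFunLike.congr_fun (exp_smul_mul_exp_smul_neg L t) (B.mulVec (u t)))

/-- The functionals that annihilate `exp (-s A) B` on `[0, 1]` form a space that is invariant under
the transpose of `A` (differentiate in `s`) and annihilate `B` (put `s = 0`), so that the system is
controllable when there is no such space but the zero space. -/
theorem controllable_of_invariant_eq_bot {n : ℕ} {ι : Type*} [Fintype ι]
    (A : Matrix (Fin n) (Fin n) ℝ) (B : Matrix (Fin n) ι ℝ)
    (h : ∀ V : Submodule ℝ (Fin n → ℝ), (∀ w ∈ V, A.vecMul w ∈ V) →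
      (∀ w ∈ V, B.vecMul w = 0) → V = ⊥) : Controllable A B := by
  apply controllable_of_forall_integral_exp
  set L := LinearMap.toContinuousLinearMap A.mulVecLin with hL
  apply exists_integral_exp_eq
  intro f hf
  let V : Submodule ℝ (Fin n → ℝ) :=
    { carrier := {w | ∀ s ∈ Set.Icc (0 : ℝ) 1, ∀ j,
        w ⬝ᵥ NormedSpace.exp (s • (-L)) (B.col j) = 0}
      zero_mem' := by simp
      add_mem' := fun {v w} hv hw s hs j => by rw [add_dotProduct, hv s hs, hw s hs, add_zero]
      smul_mem' := fun c w hw s hs j => by rw [smul_dotProduct, hw s hs, smul_zero] }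
  have hV : V = ⊥ := by
    apply h
    · intro w hw s hs j
      have hd : HasDerivAt (fun s : ℝ => w ⬝ᵥ NormedSpace.exp (s • (-L)) (B.col j))
          (w ⬝ᵥ ((-L) * NormedSpace.exp (s • (-L))) (B.col j)) s := by
        let F : (Fin n → ℝ) →L[ℝ] ℝ :=
          LinearMap.toContinuousLinearMap (dotProductBilin ℝ ℝ w)
        have := (hasDerivAt_exp_smul_const' (-L) s).clm_apply (hasDerivAt_const s (B.col j))
        simp only [map_zero, add_zero] at this
        exact F.hasFDerivAt.comp_hasDerivAt s this
      have hd0 : HasDerivWithinAt (fun s : ℝ => w ⬝ᵥ NormedSpace.exp (s • (-L)) (B.col j)) 0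
          (Set.Icc 0 1) s :=
        (hasDerivWithinAt_const s _ 0).congr (fun t ht => hw t ht j) (hw s hs j)
      have := (uniqueDiffOn_Icc zero_lt_one s hs).eq_deriv _ hd.hasDerivWithinAt hd0
      rw [← Matrix.dotProduct_mulVec]
      rw [mul_apply_eq_comp, neg_apply, dotProduct_neg,
        neg_eq_zero] at this
      exact this
    · intro w hw
      ext j
      have := hw 0 (by simp) j
      rw [zero_smul, NormedSpace.exp_zero] at this
      exact this
  have hfV : (fun i => f (Pi.single i 1)) ∈ V := by
    intro s hs j
    rw [← hf s hs j]
    conv_rhs => rw [pi_eq_sum_univ' (NormedSpace.exp (s • (-L)) (B.col j)), map_sum]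
    simp [dotProduct, mul_comm]
  rw [hV, Submodule.mem_bot] at hfV
  refine ContinuousLinearMap.ext fun y => ?_
  rw [pi_eq_sum_univ' y, map_sum]
  exact Finset.sum_eq_zero fun i _ => by
    rw [map_smul, show f (Pi.single i 1) = 0 from congrFun hfV i, smul_zero]

theorem re_vecMul_map_ofReal {n m : Type*} [Fintype n] (M : Matrix n m ℝ) (w : n → ℂ) (j : m) :
    ((M.map Complex.ofReal).vecMul w j).re = M.vecMul (fun i => (w i).re) j := by
  simp [Matrix.vecMul, dotProduct]

theorem im_vecMul_map_ofReal {n m : Type*} [Fintype n] (M : Matrix n m ℝ) (w : n → ℂ) (j : m) :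
    ((M.map Complex.ofReal).vecMul w j).im = M.vecMul (fun i => (w i).im) j := by
  simp [Matrix.vecMul, dotProduct]

/-- The Popov-Belevitch-Hautus test: the system is controllable if no left eigenvector of `A`, real
or complex, is orthogonal to all columns of `B`. -/
theorem controllable_of_forall_left_eigenvector {n : ℕ} {ι : Type*} [Fintype ι]
    (A : Matrix (Fin n) (Fin n) ℝ) (B : Matrix (Fin n) ι ℝ)
    (h : ∀ (μ : ℂ) (w : Fin n → ℂ), (A.map Complex.ofReal).vecMul w = μ • w →
      (B.map Complex.ofReal).vecMul w = 0 → w = 0) : Controllable A B := by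
  apply controllable_of_invariant_eq_bot
  intro V hVA hVB
  -- the complexification of `V`
  let W : Submodule ℂ (Fin n → ℂ) :=
    { carrier := {w | (fun i => (w i).re) ∈ V ∧ (fun i => (w i).im) ∈ V}
      zero_mem' := ⟨V.zero_mem, V.zero_mem⟩
      add_mem' := fun {v w} hv hw => ⟨V.add_mem hv.1 hw.1, V.add_mem hv.2 hw.2⟩
      smul_mem' := fun c w hw => by
        refine ⟨?_, ?_⟩
        · convert V.sub_mem (V.smul_mem c.re hw.1) (V.smul_mem c.im hw.2) using 1
          ext i; simp
        · convert V.add_mem (V.smul_mem c.re hw.2) (V.smul_mem c.im hw.1) using 1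
          ext i; simp }
  have hWA : ∀ w ∈ W, (A.map Complex.ofReal).vecMulLinear w ∈ W := by
    intro w hw
    refine ⟨?_, ?_⟩
    · convert hVA _ hw.1 using 1
      ext j; exact re_vecMul_map_ofReal A w j
    · convert hVA _ hw.2 using 1
      ext j; exact im_vecMul_map_ofReal A w j
  have hWB : ∀ w ∈ W, (B.map Complex.ofReal).vecMul w = 0 := by
    intro w hw
    ext j
    apply Complex.ext
    · rw [re_vecMul_map_ofReal, hVB _ hw.1]; rfl
    · rw [im_vecMul_map_ofReal, hVB _ hw.2]; rfl
  have hW : W = ⊥ := by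
    by_contra hne
    have : Nontrivial W := Submodule.nontrivial_iff_ne_bot.2 hne
    obtain ⟨μ, hμ⟩ :=
      Module.End.exists_eigenvalue ((A.map Complex.ofReal).vecMulLinear.restrict hWA)
    obtain ⟨⟨w, hw⟩, hμw, hw0⟩ := hμ.exists_hasEigenvector
    rw [Module.End.mem_eigenspace_iff] at hμw
    exact hw0 (Subtype.ext (h μ w (congrArg Subtype.val hμw) (hWB w hw)))
  rw [Submodule.eq_bot_iff]
  intro v hv
  have : (fun i => (v i : ℂ)) ∈ W := by
    refine ⟨by simpa using hv, ?_⟩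
    simp only [Complex.ofReal_im]
    exact V.zero_mem
  rw [hW, Submodule.mem_bot] at this
  exact funext fun i => Complex.ofReal_eq_zero.1 (congrFun this i)

/-! ### A necessary condition for controllability -/

/-- A system is not controllable if some nonempty set `N` of states evolves autonomously, with no
influence from the other states or from the inputs: started at zero, these states stay zero. -/
theorem not_controllable_of_autonomous {n : ℕ} {ι : Type*} [Fintype ι]
    {A : Matrix (Fin n) (Fin n) ℝ} {B : Matrix (Fin n) ι ℝ} {N : Set (Fin n)} (hN : N.Nonempty)
    (hA : ∀ v ∈ N, ∀ u ∉ N, A v u = 0) (hB : ∀ v ∈ N, ∀ j, B v j = 0) :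
    ¬ Controllable A B := by
  classical
  intro hc
  obtain ⟨r, hr⟩ := hN
  obtain ⟨T, hT, u, x, -, h0, h1, hx⟩ := hc 0 1
  let Q : (Fin n → ℝ) →L[ℝ] (Fin n → ℝ) :=
    ContinuousLinearMap.pi fun i => if i ∈ N then ContinuousLinearMap.proj i else 0
  have hQ : ∀ y i, Q y i = if i ∈ N then y i else 0 := by
    intro y i
    by_cases hi : i ∈ N <;> simp [Q, hi]
  let L : (Fin n → ℝ) →L[ℝ] (Fin n → ℝ) :=
    Q.comp (LinearMap.toContinuousLinearMap A.mulVecLin)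
  have hy : ∀ t ∈ Set.Icc 0 T, HasDerivAt (fun t => Q (x t)) (L (Q (x t))) t := by
    intro t ht
    refine (Q.hasFDerivAt.comp_hasDerivAt t (hx t ht)).congr_deriv ?_
    symm
    funext i
    change Q (A.mulVec (Q (x t))) i = Q (A.mulVec (x t) + B.mulVec (u t)) i
    rw [hQ, hQ]
    split_ifs with hi
    · simp only [Pi.add_apply, Matrix.mulVec, dotProduct]
      rw [Finset.sum_congr rfl (g := fun j => A i j * x t j),
        Finset.sum_eq_zero (f := fun j => B i j * u t j), add_zero]
      · intro j _
        rw [hB i hi, zero_mul]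
      · intro j _
        rw [hQ]
        split_ifs with hj
        · rfl
        · rw [hA i hi j hj, zero_mul, zero_mul]
    · rfl
  have key := ODE_solution_unique (v := fun _ => L) (f := fun t => Q (x t)) (g := fun _ => 0)
    (a := 0) (b := T) (fun _ => L.lipschitz)
    (fun t ht => (hy t ht).continuousAt.continuousWithinAt)
    (fun t ht => (hy t ⟨ht.1, ht.2.le⟩).hasDerivWithinAt) continuousOn_const
    (fun t _ => by simpa using hasDerivWithinAt_const t _ (0 : Fin n → ℝ)) (by simp [h0])
  have := congrFun (key ⟨hT.le, le_rfl⟩) r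
  simp only [h1, hQ, hr, if_true, Pi.one_apply, Pi.zero_apply] at this
  exact one_ne_zero this

/-! ### Non-top-linked components -/

namespace Digraph

variable {V : Type*} {D : Digraph V}

/-- The vertex `u` is reached only from vertices that it reaches itself. These are exactly the
vertices of the non-top-linked components. -/
def IsSource (D : Digraph V) (u : V) : Prop :=
  ∀ v, D.HasPath v u → D.HasPath u v

theorem HasPath.trans {u v w : V} (h : D.HasPath u v) (h' : D.HasPath v w) : D.HasPath u w :=
  Relation.ReflTransGen.trans h h'

theorem isSCC_setOf_hasPath (D : Digraph V) (u : V) :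
    D.IsSCC {v | D.HasPath u v ∧ D.HasPath v u} := by
  refine ⟨⟨⟨u, .refl, .refl⟩, fun v hv w hw => hv.2.trans hw.1⟩, fun S hS hle w hw => ?_⟩
  have hu : u ∈ S := hle ⟨.refl, .refl⟩
  exact ⟨hS.2 u hu w hw, hS.2 w hw u hu⟩

theorem IsSCC.eq_setOf_hasPath {S : Set V} (hS : D.IsSCC S) {u : V} (hu : u ∈ S) :
    S = {v | D.HasPath u v ∧ D.HasPath v u} :=
  hS.eq_of_subset (isSCC_setOf_hasPath D u).1 fun v hv => ⟨hS.1.2 u hu v hv, hS.1.2 v hv u hu⟩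

theorem IsNonTopLinkedSCC.mem_of_hasPath {S : Set V} (hS : D.IsNonTopLinkedSCC S) {u v : V}
    (hu : u ∈ S) (h : D.HasPath v u) : v ∈ S := by
  induction h using Relation.ReflTransGen.head_induction_on with
  | refl => exact hu
  | @head a b hab _ hb =>
    by_contra ha
    refine hS.2 _ (isSCC_setOf_hasPath D a) (fun h => ha ?_) a ⟨.refl, .refl⟩ b hb hab
    rw [← h]
    exact ⟨.refl, .refl⟩

theorem IsNonTopLinkedSCC.isSource {S : Set V} (hS : D.IsNonTopLinkedSCC S) {u : V}
    (hu : u ∈ S) : D.IsSource u :=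
  fun v hv => hS.1.1.2 u hu v (hS.mem_of_hasPath hu hv)

theorem IsNonTopLinkedSCC.eq_setOf_hasPath {S : Set V} (hS : D.IsNonTopLinkedSCC S) {u : V}
    (hu : u ∈ S) : S = {v | D.HasPath v u} :=
  Set.Subset.antisymm (fun v hv => hS.1.1.2 v hv u hu) fun _ hv => hS.mem_of_hasPath hu hv

theorem IsSource.isNonTopLinkedSCC {u : V} (hu : D.IsSource u) :
    D.IsNonTopLinkedSCC {v | D.HasPath v u} := by
  have h : {v | D.HasPath v u} = {v | D.HasPath u v ∧ D.HasPath v u} :=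
    Set.ext fun v => ⟨fun hv => ⟨hu v hv, hv⟩, fun hv => hv.2⟩
  refine ⟨h ▸ isSCC_setOf_hasPath D u, fun S' hS' hne a ha b hb hab => hne ?_⟩
  have hau : D.HasPath a u := Relation.ReflTransGen.head hab hb
  rw [h]
  exact hS'.eq_of_subset (isSCC_setOf_hasPath D u).1 fun v hv =>
    ⟨(hu a hau).trans (hS'.1.2 a ha v hv), (hS'.1.2 v hv a ha).trans hau⟩

/-- A vertex with the fewest ancestors among the ancestors of `v` is a source. -/
theorem exists_isSource_hasPath [Finite V] (D : Digraph V) (v : V) :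
    ∃ u, D.IsSource u ∧ D.HasPath u v := by
  obtain ⟨u, hu, hmin⟩ := Set.exists_min_image {u | D.HasPath u v}
    (fun u => Set.ncard {w | D.HasPath w u}) (Set.toFinite _) ⟨v, .refl⟩
  refine ⟨u, fun w hw => ?_, hu⟩
  have heq : {x | D.HasPath x w} = {x | D.HasPath x u} :=
    Set.eq_of_subset_of_ncard_le (fun x hx => HasPath.trans hx hw) (hmin w (hw.trans hu))
      (Set.toFinite _)
  have : u ∈ {x | D.HasPath x u} := .refl
  rwa [← heq] at this

end Digraph

/-! ### Perfect matchings as permutations -/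

theorem HasPerfectStateMatching.exists_perm {n : ℕ} {A : StructMatrix (Fin n) (Fin n)}
    (h : HasPerfectStateMatching A) : ∃ σ : Equiv.Perm (Fin n), ∀ v, A (σ v) v = true := by
  obtain ⟨M, hM, hspan⟩ := h
  have hex : ∀ v : Fin n, ∃ u : Fin n, M.Adj (Sum.inl v) (Sum.inr u) ∧ A u v = true := by
    intro v
    obtain ⟨b, hb, -⟩ := hM (hspan (Sum.inl v))
    rcases M.adj_sub hb with ⟨x, y, hx, rfl, hxy⟩ | ⟨x, y, -, hy, -⟩
    · cases hx
      exact ⟨y, hb, hxy⟩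
    · cases hy
  choose f hf hfA using hex
  have hinj : Function.Injective f := by
    intro v v' hvv
    have h1 := (hf v).symm
    have h2 := (hf v').symm
    rw [← hvv] at h2
    exact Sum.inl_injective ((hM (hspan (Sum.inr (f v)))).unique h1 h2)
  exact ⟨Equiv.ofBijective f (Finite.injective_iff_bijective.1 hinj), hfA⟩

/-! ### Spanning forests of the cycles of a permutation -/

theorem Equiv.Perm.SameCycle.induction_on {V : Type*} [Finite V] {σ : Equiv.Perm V}
    {S : V → Prop} {x y : V} (h : σ.SameCycle x y) (hx : S x) (hσ : ∀ z, S z → S (σ z)) : S y := by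
  obtain ⟨i, rfl⟩ := h.exists_nat_pow_eq
  induction i with
  | zero => exact hx
  | succ i ih =>
    rw [pow_succ', Equiv.Perm.mul_apply]
    exact hσ _ (ih ⟨i, by simp⟩)

/-- The breadth-first depth of classes of vertices. The classes are the fibres of `c`, a class
lies below another one when an edge leads into it from that one, and those of the vertices
satisfying `root` have depth zero. -/
theorem exists_depth {V C : Type*} (c : V → C) (E : V → V → Prop) (root : V → Prop)
    (h : ∀ v, ∃ r, root r ∧ Relation.ReflTransGen E r v) :
    ∃ d : V → ℕ, (∀ u v, c u = c v → d u = d v) ∧ (∀ v, d v = 0 → ∃ r, root r ∧ c r = c v) ∧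
      ∀ v, d v ≠ 0 → ∃ p q, E p q ∧ c q = c v ∧ d v = d p + 1 := by
  classical
  let lvl : ℕ → V → Prop := Nat.rec (motive := fun _ => V → Prop) (fun v => ∃ r, root r ∧ c r = c v)
    (fun _ L v => ∃ p q, L p ∧ E p q ∧ c q = c v)
  have hlvl : ∀ v, ∃ k, lvl k v := by
    intro v
    obtain ⟨r, hr, hv⟩ := h v
    induction hv with
    | refl => exact ⟨0, r, hr, rfl⟩
    | @tail p q _ hpq ih =>
      obtain ⟨k, hk⟩ := ih
      exact ⟨k + 1, p, q, hk, hpq, rfl⟩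
  have hc : ∀ k u v, c u = c v → lvl k u → lvl k v := by
    rintro (_ | k) u v huv
    · rintro ⟨r, hr, hu⟩
      exact ⟨r, hr, hu.trans huv⟩
    · rintro ⟨p, q, hp, hpq, hu⟩
      exact ⟨p, q, hp, hpq, hu.trans huv⟩
  let d : V → ℕ := fun v => Nat.find (hlvl v)
  refine ⟨d, fun u v huv => ?_, fun v hv => ?_, fun v hv => ?_⟩
  · exact le_antisymm (Nat.find_min' _ (hc _ _ _ huv.symm (Nat.find_spec (hlvl v))))
      (Nat.find_min' _ (hc _ _ _ huv (Nat.find_spec (hlvl u))))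
  · have := Nat.find_spec (hlvl v)
    rw [show Nat.find (hlvl v) = 0 from hv] at this
    exact this
  · obtain ⟨k, hk⟩ := Nat.exists_eq_succ_of_ne_zero hv
    have hs := Nat.find_spec (hlvl v)
    rw [show Nat.find (hlvl v) = k + 1 from hk] at hs
    obtain ⟨p, q, hp, hpq, hq⟩ := hs
    refine ⟨p, q, hpq, hq, ?_⟩
    have h1 : Nat.find (hlvl p) ≤ k := Nat.find_min' _ hp
    have h2 : Nat.find (hlvl v) ≤ Nat.find (hlvl p) + 1 :=
      Nat.find_min' _ ⟨p, q, Nat.find_spec (hlvl p), hpq, hq⟩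
    exact le_antisymm h2 (hk ▸ Nat.succ_le_succ h1)

/-- A spanning forest of the cycles of a permutation `σ`, which are represented by the values of
`c`. Each cycle of depth zero is entered by one input edge, each other cycle by one edge coming
from a cycle that is less deep by one. -/
structure CycleForest {V ι : Type*} (σ : Equiv.Perm V) (E : V → V → Prop) (I : V → ι → Prop) where
  /-- the label of the cycle of a vertex -/
  c : V → V
  /-- the depth of the cycle of a vertex -/
  d : V → ℕ
  /-- the edges of the forest -/
  T : V → V → Prop
  /-- the input edges at the roots -/
  R : V → ι → Prop
  c_eq_iff : ∀ u v, c u = c v ↔ σ.SameCycle u v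
  d_eq : ∀ u v, c u = c v → d u = d v
  edge_of_T : ∀ p q, T p q → E p q
  d_of_T : ∀ p q, T p q → d q = d p + 1
  exists_T : ∀ v, d v ≠ 0 → ∃ p q, T p q ∧ c q = c v
  T_unique : ∀ p q p' q', T p q → T p' q' → c q = c q' → p = p' ∧ q = q'
  input_of_R : ∀ r j, R r j → I r j
  d_of_R : ∀ r j, R r j → d r = 0
  exists_R : ∀ v, d v = 0 → ∃ r j, R r j ∧ c r = c v
  R_unique : ∀ r j r' j', R r j → R r' j' → c r = c r' → r = r'

theorem nonempty_cycleForest {V ι : Type*} (σ : Equiv.Perm V) (E : V → V → Prop)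
    (I : V → ι → Prop) (h : ∀ v, ∃ r j, I r j ∧ Relation.ReflTransGen E r v) :
    Nonempty (CycleForest σ E I) := by
  let c : V → V := fun v => (Quotient.mk (Equiv.Perm.SameCycle.setoid σ) v).out
  have hc : ∀ u v, c u = c v ↔ σ.SameCycle u v := by
    intro u v
    refine (Quotient.out_injective.eq_iff).trans ?_
    exact Quotient.eq
  have hcc : ∀ v, c (c v) = c v := fun v => congrArg Quotient.out (Quotient.out_eq _)
  obtain ⟨d, hd, hd0, hds⟩ := exists_depth c E (fun r => ∃ j, I r j) (by
    intro v
    obtain ⟨r, j, hr, hv⟩ := h v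
    exact ⟨r, ⟨j, hr⟩, hv⟩)
  have hdc : ∀ v, d (c v) = d v := fun v => hd _ _ (hcc v)
  choose p q hE hq hdp using hds
  choose r hr hrc using hd0
  choose j hj using hr
  -- the edges are chosen at the representatives of the cycles, so that each cycle has only one
  refine ⟨⟨c, d, fun x y => ∃ v, ∃ h : d (c v) ≠ 0, x = p _ h ∧ y = q _ h,
    fun x i => ∃ v, ∃ h : d (c v) = 0, x = r _ h ∧ i = j _ h, hc, hd, ?_, ?_, ?_, ?_, ?_, ?_,
    ?_, ?_⟩⟩
  · rintro _ _ ⟨v, h, rfl, rfl⟩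
    exact hE _ h
  · rintro _ _ ⟨v, h, rfl, rfl⟩
    rw [hd _ _ (hq _ h), ← hdp]
  · intro v hv
    have h : d (c v) ≠ 0 := by rwa [hdc]
    exact ⟨_, _, ⟨v, h, rfl, rfl⟩, (hq _ h).trans (hcc v)⟩
  · rintro _ _ _ _ ⟨v, h, rfl, rfl⟩ ⟨v', h', rfl, rfl⟩ heq
    rw [hq, hq, hcc, hcc] at heq
    simp only [heq, and_self]
  · rintro _ _ ⟨v, h, rfl, rfl⟩
    exact hj _ h
  · rintro _ _ ⟨v, h, rfl, rfl⟩
    rw [hd _ _ (hrc _ h), h]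
  · intro v hv
    have h : d (c v) = 0 := by rwa [hdc]
    exact ⟨_, _, ⟨v, h, rfl, rfl⟩, (hrc _ h).trans (hcc v)⟩
  · rintro _ _ _ _ ⟨v, h, rfl, rfl⟩ ⟨v', h', rfl, rfl⟩ heq
    rw [hrc, hrc, hcc, hcc] at heq
    simp only [heq]

/-! ### Left eigenvectors of weighted cycles joined by a forest -/

/-- On a cycle with constant weight `a`, the solution of the eigenvector equation has constant
absolute value, and the eigenvalue has absolute value `a`. -/
theorem norm_eq_of_cycle_eigenvector {V : Type*} [Finite V] {σ : Equiv.Perm V} {w : V → ℂ} {μ : ℂ}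
    {a : ℝ} (ha : 0 < a) {x : V} (hx : w x ≠ 0)
    (h : ∀ v, σ.SameCycle x v → (a : ℂ) * w (σ v) = μ * w v) :
    ‖μ‖ = a ∧ ∀ v, σ.SameCycle x v → w v ≠ 0 := by
  have hstep : ∀ v, σ.SameCycle x v → ‖w (σ v)‖ = ‖μ‖ / a * ‖w v‖ := by
    intro v hv
    have := congrArg norm (h v hv)
    rw [norm_mul, norm_mul, Complex.norm_of_nonneg ha.le] at this
    field_simp
    linarith
  have hpow : ∀ i : ℕ, ‖w ((σ ^ i) x)‖ = (‖μ‖ / a) ^ i * ‖w x‖ := by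
    intro i
    induction i with
    | zero => simp
    | succ i ih =>
      rw [pow_succ', Equiv.Perm.mul_apply, hstep _ ⟨i, by simp⟩, ih]
      ring
  have hw : ‖w x‖ ≠ 0 := norm_ne_zero_iff.2 hx
  have h1 : ‖μ‖ / a = 1 := by
    have := hpow (orderOf σ)
    rw [pow_orderOf_eq_one, Equiv.Perm.one_apply, eq_comm, mul_eq_right₀ hw] at this
    exact (pow_eq_one_iff_of_nonneg (by positivity) (orderOf_pos σ).ne').1 this
  refine ⟨(div_eq_one_iff_eq ha.ne').1 h1, fun v hv => ?_⟩
  obtain ⟨i, rfl⟩ := hv.exists_nat_pow_eq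
  rw [← norm_ne_zero_iff, hpow, h1, one_pow, one_mul]
  exact hw

/-- If the eigenvector equation of a weighted cycle has a nonzero source term `b`, concentrated at
one vertex `p`, and the eigenvalue is not zero, then the solution vanishes nowhere. -/
theorem ne_zero_of_cycle_eigenvector_source {V : Type*} [Finite V] {σ : Equiv.Perm V} {w : V → ℂ}
    {μ a b : ℂ} {p : V} (hμ : μ ≠ 0) (hb : b ≠ 0) (hp : a * w (σ p) + b = μ * w p)
    (h : ∀ v, σ.SameCycle p v → v ≠ p → a * w (σ v) = μ * w v) (ha : a ≠ 0) :
    ∀ v, σ.SameCycle p v → w v ≠ 0 := by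
  have hpp : σ.SameCycle (σ p) p := (Equiv.Perm.SameCycle.refl σ p).apply_left
  have hσp : w (σ p) ≠ 0 := by
    intro h0
    -- going once around the cycle, the value zero would come back to `p`
    have := hpp.induction_on (S := fun v => σ.SameCycle p v ∧ w v = 0) ⟨hpp.symm, h0⟩ (by
      rintro v ⟨hv, hv0⟩
      refine ⟨hv.apply_right, ?_⟩
      by_cases hvp : v = p
      · rwa [hvp]
      · have := h v hv hvp
        rw [hv0, mul_zero] at this
        exact (mul_eq_zero.1 this).resolve_left ha)
    rw [h0, this.2, mul_zero, mul_zero, zero_add] at hp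
    exact hb hp
  intro v hv
  refine ((hpp.trans hv).induction_on (S := fun v => σ.SameCycle p v ∧ w v ≠ 0) ⟨hpp.symm, hσp⟩
    ?_).2
  rintro v ⟨hv, hv0⟩
  refine ⟨hv.apply_right, fun h0 => ?_⟩
  by_cases hvp : v = p
  · exact hσp (hvp ▸ h0)
  · have := h v hv hvp
    rw [h0, mul_zero] at this
    exact mul_ne_zero hμ hv0 this.symm

namespace CycleForest

variable {V ι : Type*} [Fintype V] {σ : Equiv.Perm V} {E : V → V → Prop} {I : V → ι → Prop}

open Classical in
/-- The Popov-Belevitch-Hautus test for the matrix made of the cycles of `σ`, with a constant weight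
on each cycle that differs from cycle to cycle, and of the edges of the forest. Going up from the
deepest cycles, a left eigenvector `w` is zero until the cycle is met whose weight is the absolute
value of the eigenvalue; from there on it is nonzero everywhere on the ancestors of that cycle, and
zero on all other cycles. It is thus nonzero at the input edge of exactly one root, or zero. -/
theorem eigenvector_eq_zero (F : CycleForest σ E I) {a : V → ℝ} (ha : ∀ v, 0 < a v)
    (hac : ∀ u v, a u = a v ↔ F.c u = F.c v) {w : V → ℂ} {μ : ℂ}
    (hA : ∀ v, (a v : ℂ) * w (σ v) + ∑ u, (if F.T v u then w u else 0) = μ * w v)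
    (hB : ∀ j, ∑ u, (if F.R u j then w u else 0) = 0) : w = 0 := by
  have hsame : ∀ {u v}, σ.SameCycle u v → F.c u = F.c v := fun h => (F.c_eq_iff _ _).2 h
  have hsrc : ∀ x, w x ≠ 0 → (∀ v, F.c v = F.c x → ∀ u, F.T v u → w u = 0) →
      ‖μ‖ = a x ∧ ∀ v, F.c v = F.c x → w v ≠ 0 := by
    intro x hx hT
    have := norm_eq_of_cycle_eigenvector (σ := σ) (μ := μ) (ha x) hx (by
      intro v hv
      rw [← hA v, Finset.sum_eq_zero, add_zero, (hac x v).2 (hsame hv)]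
      intro u _
      split_ifs with hu
      · exact hT v (hsame hv).symm u hu
      · rfl)
    exact ⟨this.1, fun v hv => this.2 v ((F.c_eq_iff _ _).1 hv.symm)⟩
  let Z : ℕ → Prop := fun k => ∀ v, k ≤ F.d v → w v = 0
  let O : ℕ → Prop := fun k => ∃ v₀, F.d v₀ = k ∧ (∀ v, F.d v = k → (w v ≠ 0 ↔ F.c v = F.c v₀)) ∧
    ∃ x, ‖μ‖ = a x ∧ k ≤ F.d x
  have hstep : ∀ k, Z (k + 1) ∨ O (k + 1) → Z k ∨ O k := by
    rintro k (hZ | ⟨v₁, hdv₁, hv₁, x, hx, hdx⟩)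
    · have hT : ∀ x, F.d x = k → ∀ v, F.c v = F.c x → ∀ u, F.T v u → w u = 0 := by
        intro x hx v hv u hu
        exact hZ u (by rw [F.d_of_T _ _ hu, F.d_eq _ _ hv, hx])
      by_cases hex : ∃ v₀, F.d v₀ = k ∧ w v₀ ≠ 0
      · obtain ⟨v₀, hd₀, hw₀⟩ := hex
        obtain ⟨hμ, hne⟩ := hsrc v₀ hw₀ (hT v₀ hd₀)
        refine Or.inr ⟨v₀, hd₀, fun v hv => ⟨fun hw => ?_, hne v⟩, v₀, hμ, hd₀.ge⟩
        exact (hac _ _).1 ((hsrc v hw (hT v hv)).1.symm.trans hμ)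
      · push Not at hex
        refine Or.inl fun v hv => ?_
        rcases hv.eq_or_lt with hv | hv
        · exact hex v hv.symm
        · exact hZ v hv
    · obtain ⟨p, q, hpq, hq⟩ := F.exists_T v₁ (by rw [hdv₁]; exact Nat.succ_ne_zero k)
      have hdp : F.d p = k := by
        have := F.d_of_T _ _ hpq
        rw [F.d_eq _ _ hq, hdv₁] at this
        omega
      have hdq : F.d q = k + 1 := by rw [F.d_of_T _ _ hpq, hdp]
      have hT : ∀ v, F.d v = k → ∀ u, F.T v u → w u ≠ 0 → v = p ∧ u = q := by
        intro v hv u hu hwu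
        have := (hv₁ u (by rw [F.d_of_T _ _ hu, hv])).1 hwu
        exact F.T_unique _ _ _ _ hu hpq (this.trans hq.symm)
      have hwq : w q ≠ 0 := (hv₁ q hdq).2 hq
      have hμ : μ ≠ 0 := by
        rw [← norm_ne_zero_iff, hx]
        exact (ha x).ne'
      refine Or.inr ⟨p, hdp, fun v hv => ⟨fun hw => ?_, fun hc => ?_⟩, x, hx, by omega⟩
      · by_contra hne
        have := (hsrc v hw fun v' hv' u hu => by
          by_contra hwu
          rw [(hT v' ((F.d_eq _ _ hv').trans hv) u hu hwu).1] at hv'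
          exact hne hv'.symm).1
        have := F.d_eq _ _ ((hac _ _).1 (this.symm.trans hx))
        omega
      · refine ne_zero_of_cycle_eigenvector_source (a := a p) hμ hwq ?_ ?_ ?_ v
          ((F.c_eq_iff _ _).1 hc.symm)
        · rw [← hA p, Finset.sum_eq_single_of_mem q (Finset.mem_univ _), if_pos hpq]
          intro u _ huq
          split_ifs with hu
          · by_contra hwu
            exact huq (hT p hdp u hu hwu).2
          · rfl
        · intro y hy hyp
          rw [← hA y, Finset.sum_eq_zero, add_zero, (hac p y).2 (hsame hy)]
          intro u _
          split_ifs with hu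
          · by_contra hwu
            exact hyp (hT y ((F.d_eq _ _ (hsame hy)).symm.trans hdp) u hu hwu).1
          · rfl
        · exact_mod_cast (ha p).ne'
  have hall : ∀ m k, Finset.univ.sup F.d < k + m → Z k ∨ O k := by
    intro m
    induction m with
    | zero =>
      refine fun k hk => Or.inl fun v hv => ?_
      have := Finset.le_sup (f := F.d) (Finset.mem_univ v)
      omega
    | succ m ih => exact fun k hk => hstep k (ih (k + 1) (by omega))
  rcases hall (Finset.univ.sup F.d + 1) 0 (by omega) with hZ | ⟨v₀, hd₀, hv₀, -⟩
  · exact funext fun v => hZ v (Nat.zero_le _)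
  · obtain ⟨r, j, hr, hrc⟩ := F.exists_R v₀ hd₀
    have := hB j
    rw [Finset.sum_eq_single_of_mem r (Finset.mem_univ _), if_pos hr] at this
    · exact absurd this ((hv₀ r (F.d_of_R _ _ hr)).2 hrc)
    · intro u _ hur
      split_ifs with hu
      · by_contra hwu
        exact hur (F.R_unique _ _ _ _ hu hr
          (((hv₀ u (F.d_of_R _ _ hu)).1 hwu).trans hrc.symm))
      · rfl

end CycleForest

/-! ### Structural controllability and set covers -/

/-- If the stars of `A` contain a permutation, and every state can be reached from an actuated
state, then the pair is structurally controllable. -/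
theorem structurallyControllable_of_reachable {n : ℕ} {ι : Type*} [Fintype ι]
    {A : StructMatrix (Fin n) (Fin n)} {B : StructMatrix (Fin n) ι} (σ : Equiv.Perm (Fin n))
    (hσ : ∀ v, A (σ v) v = true)
    (h : ∀ v, ∃ r j, B r j = true ∧ (stateDigraph A).HasPath r v) :
    StructurallyControllable A B := by
  classical
  obtain ⟨F⟩ := nonempty_cycleForest σ (stateDigraph A).Adj (fun r j => B r j = true) h
  let a : Fin n → ℝ := fun v => (F.c v : ℕ) + 1
  refine ⟨Matrix.of fun u v => (if u = σ v then a v else 0) + (if F.T v u then 1 else 0),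
    Matrix.of fun u j => if F.R u j then 1 else 0, fun u v huv => ?_, fun u j huj => ?_, ?_⟩
  · rw [Matrix.of_apply, if_neg, if_neg, add_zero]
    · intro hT
      have : A u v = true := F.edge_of_T _ _ hT
      simp [huv] at this
    · rintro rfl
      simp [hσ] at huv
  · rw [Matrix.of_apply, if_neg]
    intro hR
    have := F.input_of_R _ _ hR
    simp [huj] at this
  · apply controllable_of_forall_left_eigenvector
    intro μ w hwA hwB
    refine F.eigenvector_eq_zero (a := a) (fun v => by positivity) (fun u v => ?_) (μ := μ)
      (fun v => ?_) (fun j => ?_)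
    · simp [a, Fin.val_inj]
    · have := congrFun hwA v
      simp only [Pi.smul_apply, smul_eq_mul] at this
      rw [← this]
      simp only [Matrix.vecMul, dotProduct, Matrix.map_apply, Matrix.of_apply,
        Complex.ofReal_add, mul_add, Finset.sum_add_distrib]
      refine congrArg₂ (· + ·) ?_ ?_
      · rw [Finset.sum_eq_single_of_mem (σ v) (Finset.mem_univ (σ v)), if_pos rfl, mul_comm]
        intro u _ hu
        rw [if_neg hu, Complex.ofReal_zero, mul_zero]
      · refine Finset.sum_congr rfl fun u _ => ?_
        split_ifs <;> simp
    · have := congrFun hwB j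
      refine Eq.trans ?_ this
      simp only [Matrix.vecMul, dotProduct, Matrix.map_apply, Matrix.of_apply]
      refine Finset.sum_congr rfl fun u _ => ?_
      split_ifs <;> simp

theorem isInputSelection_iff_isSetCover {n p k : ℕ} {A : StructMatrix (Fin n) (Fin n)}
    {B : StructMatrix (Fin n) (Fin p)} (hA : HasPerfectStateMatching A)
    (N : Fin k ≃ NonTopLinkedSCC A) (J : Finset (Fin p)) :
    IsInputSelection A B J ↔ IsSetCover (coverSet A B N) J := by
  constructor
  · rintro ⟨A', B', hA', hB', hc⟩
    refine Set.eq_univ_of_forall fun i => ?_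
    by_contra hi
    simp only [Set.mem_iUnion, not_exists] at hi
    have hS := (N i).2
    refine not_controllable_of_autonomous hS.1.1.1 (fun v hv u hu => hA' v u ?_)
      (fun v hv j => hB' v j ?_) hc
    · by_contra hvu
      exact hu (hS.mem_of_hasPath hv (Relation.ReflTransGen.single (Bool.of_not_eq_false hvu)))
    · by_contra hvj
      exact hi j.1 j.2 ⟨v, Bool.of_not_eq_false hvj, hv⟩
  · intro hJ
    obtain ⟨σ, hσ⟩ := hA.exists_perm
    refine structurallyControllable_of_reachable σ hσ fun v => ?_
    obtain ⟨u, hu, huv⟩ := (stateDigraph A).exists_isSource_hasPath v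
    have hi : N.symm ⟨_, hu.isNonTopLinkedSCC⟩ ∈ ⋃ j ∈ J, coverSet A B N j :=
      hJ ▸ Set.mem_univ _
    simp only [Set.mem_iUnion] at hi
    obtain ⟨j, hj, r, hr, hru⟩ := hi
    rw [Equiv.apply_symm_apply] at hru
    exact ⟨r, ⟨j, hj⟩, hr, Digraph.HasPath.trans hru huv⟩

theorem isMinInputSelection_iff_isMinSetCover {n p k : ℕ} {A : StructMatrix (Fin n) (Fin n)}
    {B : StructMatrix (Fin n) (Fin p)} (hA : HasPerfectStateMatching A)
    (N : Fin k ≃ NonTopLinkedSCC A) (J : Finset (Fin p)) :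
    IsMinInputSelection A B J ↔ IsMinSetCover (coverSet A B N) J := by
  simp only [IsMinInputSelection, IsMinSetCover, isInputSelection_iff_isSetCover hA N]

/-! ### Reasoning about programs and their running time -/

namespace RAM

theorem Store.reg_setReg (s : Store) (x v y : ℕ) :
    (s.setReg x v).reg y = if y = x then v else s.reg y := by
  simp [Store.setReg, Function.update_apply]

theorem Store.arr_setReg (s : Store) (x v : ℕ) : (s.setReg x v).arr = s.arr := rfl

theorem Store.reg_setArr (s : Store) (a i v : ℕ) : (s.setArr a i v).reg = s.reg := rfl

theorem Store.arr_setArr (s : Store) (a i v b j : ℕ) :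
    (s.setArr a i v).arr b j = if b = a ∧ j = i then v else s.arr b j := by
  by_cases hb : b = a
  · subst hb
    simp [Store.setArr, Function.update_apply]
  · simp [Store.setArr, hb]

/-- The registers that a program may modify. -/
def Program.regs : Program → List ℕ
  | .skip => []
  | .const x _ => [x]
  | .add x _ _ => [x]
  | .sub x _ _ => [x]
  | .load x _ _ => [x]
  | .store _ _ _ => []
  | .seq c d => c.regs ++ d.regs
  | .branch _ c d => c.regs ++ d.regs
  | .loop _ c => c.regs

/-- The arrays that a program may modify. -/
def Program.arrs : Program → List ℕ
  | .store a _ _ => [a]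
  | .seq c d => c.arrs ++ d.arrs
  | .branch _ c d => c.arrs ++ d.arrs
  | .loop _ c => c.arrs
  | _ => []

theorem Runs.frame {c : Program} {s s' : Store} {t : ℕ} (h : Runs c s t s') :
    (∀ y ∉ c.regs, s'.reg y = s.reg y) ∧ ∀ a ∉ c.arrs, s'.arr a = s.arr a := by
  induction h with
  | seq _ _ ih ih' =>
    simp only [Program.regs, Program.arrs, List.mem_append, not_or]
    exact ⟨fun y hy => (ih'.1 y hy.2).trans (ih.1 y hy.1),
      fun a ha => (ih'.2 a ha.2).trans (ih.2 a ha.1)⟩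
  | branch_true _ _ ih =>
    simp only [Program.regs, Program.arrs, List.mem_append, not_or]
    exact ⟨fun y hy => ih.1 y hy.1, fun a ha => ih.2 a ha.1⟩
  | branch_false _ _ ih =>
    simp only [Program.regs, Program.arrs, List.mem_append, not_or]
    exact ⟨fun y hy => ih.1 y hy.2, fun a ha => ih.2 a ha.2⟩
  | loop_true _ _ _ ih ih' =>
    exact ⟨fun y hy => (ih'.1 y hy).trans (ih.1 y hy), fun a ha => (ih'.2 a ha).trans (ih.2 a ha)⟩
  | store s a y x =>
    refine ⟨fun _ _ => rfl, fun b hb => ?_⟩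
    simp only [Program.arrs, List.mem_singleton] at hb
    exact Function.update_of_ne hb _ _
  | skip => exact ⟨fun _ _ => rfl, fun _ _ => rfl⟩
  | loop_false => exact ⟨fun _ _ => rfl, fun _ _ => rfl⟩
  | _ =>
    refine ⟨fun y hy => ?_, fun _ _ => rfl⟩
    simp only [Program.regs, List.mem_singleton] at hy
    exact Function.update_of_ne hy _ _

open Polynomial in
/-- A bound for the running time of a program in which no loop is iterated more than `X` times
each time that it is executed. -/
noncomputable def Program.cost : Program → ℕ[X]
  | .seq c d => c.cost + d.cost
  | .branch _ c d => c.cost + d.cost + 1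
  | .loop _ c => X * (c.cost + 1) + 1
  | _ => 1

/-- Started on `s`, the program `c` halts in a store that satisfies `Q`, after no more steps than
the value of `c.cost` at `m`. -/
def Within (m : ℕ) (c : Program) (s : Store) (Q : Store → Prop) : Prop :=
  ∃ t s', Runs c s t s' ∧ t ≤ c.cost.eval m ∧ Q s'

namespace Within

variable {m : ℕ} {c d : Program} {s : Store} {Q Q' : Store → Prop}

theorem imp (h : Within m c s Q) (hQ : ∀ s', Q s' → Q' s') : Within m c s Q' :=
  let ⟨t, s', hr, ht, hs⟩ := h
  ⟨t, s', hr, ht, hQ s' hs⟩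

theorem framed (h : Within m c s Q) : Within m c s fun s' =>
    Q s' ∧ (∀ y ∉ c.regs, s'.reg y = s.reg y) ∧ ∀ a ∉ c.arrs, s'.arr a = s.arr a :=
  let ⟨t, s', hr, ht, hs⟩ := h
  ⟨t, s', hr, ht, hs, hr.frame⟩

theorem skip (h : Q s) : Within m .skip s Q :=
  ⟨1, s, .skip s, by simp [Program.cost], h⟩

theorem const {x v : ℕ} (h : Q (s.setReg x v)) : Within m (.const x v) s Q :=
  ⟨1, _, .const s x v, by simp [Program.cost], h⟩

theorem add {x y z : ℕ} (h : Q (s.setReg x (s.reg y + s.reg z))) : Within m (.add x y z) s Q :=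
  ⟨1, _, .add s x y z, by simp [Program.cost], h⟩

theorem sub {x y z : ℕ} (h : Q (s.setReg x (s.reg y - s.reg z))) : Within m (.sub x y z) s Q :=
  ⟨1, _, .sub s x y z, by simp [Program.cost], h⟩

theorem load {x a y : ℕ} (h : Q (s.setReg x (s.arr a (s.reg y)))) : Within m (.load x a y) s Q :=
  ⟨1, _, .load s x a y, by simp [Program.cost], h⟩

theorem store {a y x : ℕ} (h : Q (s.setArr a (s.reg y) (s.reg x))) :
    Within m (.store a y x) s Q :=
  ⟨1, _, .store s a y x, by simp [Program.cost], h⟩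

theorem seq (h : Within m c s fun s' => Within m d s' Q) : Within m (.seq c d) s Q := by
  obtain ⟨t, s', hr, ht, t', s'', hr', ht', hs⟩ := h
  refine ⟨t + t', s'', .seq hr hr', ?_, hs⟩
  simp only [Program.cost, Polynomial.eval_add]
  omega

theorem branch {x : ℕ} (h : s.reg x ≠ 0 → Within m c s Q) (h' : s.reg x = 0 → Within m d s Q) :
    Within m (.branch x c d) s Q := by
  by_cases hx : s.reg x = 0
  · obtain ⟨t, s', hr, ht, hs⟩ := h' hx
    refine ⟨t + 1, s', .branch_false hx hr, ?_, hs⟩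
    simp only [Program.cost, Polynomial.eval_add, Polynomial.eval_one]
    omega
  · obtain ⟨t, s', hr, ht, hs⟩ := h hx
    refine ⟨t + 1, s', .branch_true hx hr, ?_, hs⟩
    simp only [Program.cost, Polynomial.eval_add, Polynomial.eval_one]
    omega

/-- A loop with an invariant `I j s` that tells the number `j` of iterations still to come. -/
theorem loop {x : ℕ} (I : ℕ → Store → Prop) {N : ℕ} (hN : N ≤ m) (hI : I N s)
    (h0 : ∀ s, I 0 s → s.reg x = 0 ∧ Q s)
    (hs : ∀ j s, j < N → I (j + 1) s → s.reg x ≠ 0 ∧ Within m c s (I j)) :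
    Within m (.loop x c) s Q := by
  have key : ∀ j s, j ≤ N → I j s →
      ∃ t s', Runs (.loop x c) s t s' ∧ t ≤ j * (c.cost.eval m + 1) + 1 ∧ Q s' := by
    intro j
    induction j with
    | zero =>
      intro s _ hI
      exact ⟨1, s, .loop_false (h0 s hI).1, by simp, (h0 s hI).2⟩
    | succ j ih =>
      intro s hj hI
      obtain ⟨hx, t, s', hr, ht, hI'⟩ := hs j s hj hI
      obtain ⟨t', s'', hr', ht', hQ⟩ := ih s' (by omega) hI'
      exact ⟨t + t' + 1, s'', .loop_true hx hr hr', by linarith, hQ⟩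
  obtain ⟨t, s', hr, ht, hQ⟩ := key N s le_rfl hI
  refine ⟨t, s', hr, ht.trans ?_, hQ⟩
  simp only [Program.cost, Polynomial.eval_add, Polynomial.eval_mul, Polynomial.eval_X,
    Polynomial.eval_one]
  gcongr

end Within

/-! ### Counted loops and matrix access

Register `2` holds the constant `1`, and registers `8`, `9` and `10` are scratch space. -/

/-- `for i = 0, …, b - 1 do c`, for registers `i` and `b`. -/
def forLoop (i b : ℕ) (c : Program) : Program :=
  .seq (.const i 0) (.seq (.sub 8 b i) (.loop 8 (.seq c (.seq (.add i i 2) (.sub 8 b i)))))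

theorem within_forLoop {m : ℕ} {i b : ℕ} {c : Program} {s : Store} {Q : Store → Prop} {N : ℕ}
    (I : ℕ → Store → Prop) (hN : N ≤ m) (hb : s.reg b = N) (h2 : s.reg 2 = 1)
    (h0 : I 0 ((s.setReg i 0).setReg 8 N))
    (step : ∀ k s', k < N → I k s' → s'.reg i = k →
      (∀ y ∉ i :: 8 :: c.regs, s'.reg y = s.reg y) → (∀ a ∉ c.arrs, s'.arr a = s.arr a) →
      Within m c s' fun s'' => I (k + 1) ((s''.setReg i (k + 1)).setReg 8 (N - (k + 1))))
    (hQ : ∀ s', I N s' → (∀ y ∉ i :: 8 :: c.regs, s'.reg y = s.reg y) →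
      (∀ a ∉ c.arrs, s'.arr a = s.arr a) → Q s')
    (hi : i ∉ 2 :: 8 :: c.regs := by decide) (hbi : b ∉ i :: 8 :: c.regs := by decide)
    (h2c : 2 ∉ 8 :: c.regs := by decide) :
    Within m (forLoop i b c) s Q := by
  simp only [List.mem_cons, not_or] at hi hbi h2c
  refine .seq (.const (.seq (.sub (.loop (fun j s' => j ≤ N ∧ I (N - j) s' ∧ s'.reg i = N - j ∧
    s'.reg 8 = j ∧ (∀ y ∉ i :: 8 :: c.regs, s'.reg y = s.reg y) ∧
      ∀ a ∉ c.arrs, s'.arr a = s.arr a) hN ?_ ?_ ?_))))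
  · refine ⟨le_rfl, ?_, ?_, ?_, ?_, fun _ _ => rfl⟩
    · simpa [Store.reg_setReg, hbi.1, hb] using h0
    · simp [Store.reg_setReg, hi.2.1]
    · simp [Store.reg_setReg, hbi.1, hb]
    · intro y hy
      simp only [List.mem_cons, not_or] at hy
      simp [Store.reg_setReg, hy.1, hy.2.1]
  · rintro s' ⟨-, hI, -, h8, hr, ha⟩
    exact ⟨h8, hQ s' hI hr ha⟩
  · rintro j s' hj ⟨-, hI, hk, h8, hr, ha⟩
    refine ⟨by omega, .seq ((step _ s' (by omega) hI hk hr ha).framed.imp ?_)⟩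
    rintro s'' ⟨hI', hr', ha'⟩
    have hk' : s''.reg i = N - (j + 1) := (hr' i hi.2.2).trans hk
    have hone : s''.reg 2 = 1 := by
      rw [hr' 2 h2c.2, hr 2, h2]
      simp only [List.mem_cons, not_or]
      exact ⟨fun h => hi.1 h.symm, h2c⟩
    have hb' : s''.reg b = N := by
      rw [hr' b hbi.2.2, hr b, hb]
      simpa only [List.mem_cons, not_or] using hbi
    have e1 : N - (j + 1) + 1 = N - j := by omega
    have e2 : N - (N - j) = j := by omega
    rw [e1, e2] at hI'
    refine .seq (.add (.sub ⟨hj.le, ?_, ?_, ?_, ?_, fun a h => (ha' a h).trans (ha a h)⟩))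
    · simpa [Store.reg_setReg, hk', hone, e1, hbi.1, hb', e2] using hI'
    · simp [Store.reg_setReg, hk', hone, e1, hi.2.1]
    · simp [Store.reg_setReg, hk', hone, e1, hbi.1, hb', e2]
    · intro y hy
      rw [← hr y hy]
      simp only [List.mem_cons, not_or] at hy
      rw [← hr' y hy.2.2]
      simp [Store.reg_setReg, hy.1, hy.2.1]

/-- Put into register `10` the address of the entry `(i, j)` of a matrix with `w` columns, for
registers `i`, `j` and `w`. -/
def address (i w j : ℕ) : Program :=
  .seq (.const 10 0) (.seq (forLoop 9 i (.add 10 10 w)) (.add 10 10 j))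

theorem within_address {m : ℕ} {i w j : ℕ} {s : Store} {Q : Store → Prop} (hm : s.reg i ≤ m)
    (h2 : s.reg 2 = 1)
    (hQ : ∀ s', s'.reg 10 = s.reg i * s.reg w + s.reg j → s'.arr = s.arr →
      (∀ y ∉ [8, 9, 10], s'.reg y = s.reg y) → Q s')
    (hi : i ∉ [8, 9, 10] := by decide) (hw : w ∉ [8, 9, 10] := by decide)
    (hj : j ∉ [8, 9, 10] := by decide) : Within m (address i w j) s Q := by
  have hi' := hi
  simp only [List.mem_cons, List.not_mem_nil, or_false, not_or] at hi hw hj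
  refine .seq (.const (.seq (within_forLoop (N := s.reg i)
    (fun k s' => s'.reg 10 = k * s.reg w) hm ?_ ?_ ?_ ?_ ?_ (by simp [Program.regs])
    (by simpa [Program.regs, and_left_comm] using hi) (by simp [Program.regs]))))
  · simp [Store.reg_setReg, hi]
  · simp [Store.reg_setReg, h2]
  · simp [Store.reg_setReg]
  · intro k s' _ hI _ hr _
    refine .add ?_
    have : s'.reg w = s.reg w := by
      rw [hr w (by simp [Program.regs, hw]), Store.reg_setReg, if_neg hw.2.2]
    simp [Store.reg_setReg, hI, this, Nat.succ_mul]
  · intro s' hI hr ha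
    have hr' : ∀ y ∉ [8, 9, 10], s'.reg y = s.reg y := by
      intro y hy
      simp only [List.mem_cons, List.not_mem_nil, or_false, not_or] at hy
      rw [hr y (by simp [Program.regs, hy]), Store.reg_setReg, if_neg hy.2.2]
    refine .add (hQ _ ?_ ?_ ?_)
    · rw [Store.reg_setReg, if_pos rfl, hI, hr' j (by simpa using hj)]
    · funext a
      exact ha a (by simp [Program.arrs])
    · intro y hy
      rw [Store.reg_setReg, if_neg (by rintro rfl; simp at hy), hr' y hy]

/-- `x := a[i, j]`, for a matrix `a` with `w` columns. -/
def getEntry (x a i w j : ℕ) : Program :=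
  .seq (address i w j) (.load x a 10)

/-- `a[i, j] := x`, for a matrix `a` with `w` columns. -/
def setEntry (a i w j x : ℕ) : Program :=
  .seq (address i w j) (.store a 10 x)

theorem within_getEntry {m : ℕ} {x a i w j : ℕ} {s : Store} {Q : Store → Prop}
    (hm : s.reg i ≤ m) (h2 : s.reg 2 = 1)
    (hQ : ∀ s', s'.reg x = s.arr a (s.reg i * s.reg w + s.reg j) → s'.arr = s.arr →
      (∀ y ∉ [x, 8, 9, 10], s'.reg y = s.reg y) → Q s')
    (hi : i ∉ [8, 9, 10] := by decide) (hw : w ∉ [8, 9, 10] := by decide)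
    (hj : j ∉ [8, 9, 10] := by decide) : Within m (getEntry x a i w j) s Q := by
  refine .seq (within_address hm h2 ?_ hi hw hj)
  intro s' h10 ha hr
  refine .load (hQ _ ?_ ha ?_)
  · rw [Store.reg_setReg, if_pos rfl, ha, h10]
  · intro y hy
    rw [List.mem_cons, not_or] at hy
    rw [Store.reg_setReg, if_neg hy.1, hr y hy.2]

theorem within_setEntry {m : ℕ} {a i w j x : ℕ} {s : Store} {Q : Store → Prop}
    (hm : s.reg i ≤ m) (h2 : s.reg 2 = 1)
    (hQ : ∀ s', (∀ b y, s'.arr b y =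
      if b = a ∧ y = s.reg i * s.reg w + s.reg j then s.reg x else s.arr b y) →
      (∀ y ∉ [8, 9, 10], s'.reg y = s.reg y) → Q s')
    (hi : i ∉ [8, 9, 10] := by decide) (hw : w ∉ [8, 9, 10] := by decide)
    (hj : j ∉ [8, 9, 10] := by decide) (hx : x ∉ [8, 9, 10] := by decide) :
    Within m (setEntry a i w j x) s Q := by
  refine .seq (within_address hm h2 ?_ hi hw hj)
  intro s' h10 ha hr
  refine .store (hQ _ ?_ hr)
  intro b y
  rw [Store.arr_setArr, h10, ha, hr x hx]

end RAM

/-! ### Computing the reachability relation -/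

namespace RAM

theorem entry_inj {w a b a' b' : ℕ} (hb : b < w) (hb' : b' < w) :
    a * w + b = a' * w + b' ↔ a = a' ∧ b = b' := by
  refine ⟨fun h => ?_, by rintro ⟨rfl, rfl⟩; rfl⟩
  have h1 := congrArg (· / w) h
  have h2 := congrArg (· % w) h
  have hw : 0 < w := by omega
  simp only [mul_comm _ w,
    Nat.mul_add_mod, Nat.mod_eq_of_lt hb, Nat.mod_eq_of_lt hb', Nat.mul_add_div hw,
    Nat.div_eq_of_lt hb, Nat.div_eq_of_lt hb', add_zero] at h1 h2
  exact ⟨h1, h2⟩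

/-- The `n × n` matrix in the array `0` is nonzero exactly where `R` holds. -/
def Represents (s : Store) (n : ℕ) (R : Fin n → Fin n → Prop) : Prop :=
  ∀ a b : Fin n, s.arr 0 (a * n + b) ≠ 0 ↔ R a b

theorem Represents.congr {s : Store} {n : ℕ} {R R' : Fin n → Fin n → Prop}
    (h : Represents s n R) (hR : ∀ a b, R a b ↔ R' a b) : Represents s n R' :=
  fun a b => (h a b).trans (hR a b)

theorem Represents.setEntry {s s' : Store} {n : ℕ} {R : Fin n → Fin n → Prop}
    (h : Represents s n R) (a b : Fin n)
    (hs : ∀ c y, s'.arr c y = if c = 0 ∧ y = a * n + b then 1 else s.arr c y) :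
    Represents s' n fun x y => R x y ∨ (x = a ∧ y = b) := by
  intro x y
  change _ ↔ R x y ∨ (x = a ∧ y = b)
  rw [hs, ← h x y]
  by_cases hxy : x = a ∧ y = b
  · obtain ⟨rfl, rfl⟩ := hxy
    simp
  · rw [if_neg]
    · simp [hxy]
    · rw [entry_inj y.2 b.2, Fin.val_inj, Fin.val_inj]
      tauto

/-- Make the `n × n` matrix in the array `0` reflexive. -/
def reflexiveClosure : Program :=
  forLoop 4 0 (setEntry 0 4 0 4 2)

theorem within_reflexiveClosure {m n : ℕ} {s : Store} {Q : Store → Prop}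
    {R : Fin n → Fin n → Prop} (hm : n ≤ m) (h0 : s.reg 0 = n) (h2 : s.reg 2 = 1)
    (hR : Represents s n R)
    (hQ : ∀ s', Represents s' n (fun a b => R a b ∨ a = b) →
      (∀ y ∉ reflexiveClosure.regs, s'.reg y = s.reg y) →
      (∀ a ∉ reflexiveClosure.arrs, s'.arr a = s.arr a) → Q s') :
    Within m reflexiveClosure s Q := by
  suffices h : Within m reflexiveClosure s
      fun s' => Represents s' n (fun a b => R a b ∨ a = b) from
    h.framed.imp fun s' h => hQ s' h.1 h.2.1 h.2.2
  refine within_forLoop (fun k s' => Represents s' n fun a b => R a b ∨ (a = b ∧ a.val < k))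
    hm h0 h2 (hR.congr fun a b => by simp) ?_ ?_
  · intro k s' hk hI h4 hr _
    have h0' : s'.reg 0 = n := (hr 0 (by decide)).trans h0
    have h2' : s'.reg 2 = 1 := (hr 2 (by decide)).trans h2
    refine within_setEntry (by omega) h2' fun s'' ha _ => ?_
    rw [h4, h0', h2'] at ha
    refine (hI.setEntry ⟨k, hk⟩ ⟨k, hk⟩ ha).congr fun a b => ?_
    simp only [Fin.ext_iff]
    grind
  · intro s' hI _ _
    exact hI.congr fun a b => by simp [a.2]

/-- Make the `n × n` matrix in the array `0` transitive, in place, by Warshall's algorithm. -/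
def transitiveClosure : Program :=
  forLoop 4 0 (forLoop 5 0 (forLoop 6 0 (.seq (getEntry 11 0 5 0 4) (.branch 11
    (.seq (getEntry 11 0 4 0 6) (.branch 11 (setEntry 0 5 0 6 2) .skip)) .skip))))

/-- The innermost loop of Warshall's algorithm. The row `k` and the column `k` do not change in
the course of stage `k`, so that it does not matter that the stage overwrites its input. -/
theorem within_transitiveClosure_row {m n : ℕ} {s : Store} {R : Fin n → Fin n → Prop} (k a : Fin n)
    (hm : n ≤ m) (h0 : s.reg 0 = n) (h2 : s.reg 2 = 1) (h4 : s.reg 4 = k) (h5 : s.reg 5 = a)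
    (hR : Represents s n fun x y => R x y ∨ (x < a ∧ R x k ∧ R k y)) :
    Within m (forLoop 6 0 (.seq (getEntry 11 0 5 0 4) (.branch 11
      (.seq (getEntry 11 0 4 0 6) (.branch 11 (setEntry 0 5 0 6 2) .skip)) .skip))) s
      fun s' => Represents s' n fun x y => R x y ∨ (x ≤ a ∧ R x k ∧ R k y) := by
  refine within_forLoop (fun b s' => Represents s' n fun x y =>
    R x y ∨ ((x < a ∨ x = a ∧ y.val < b) ∧ R x k ∧ R k y)) hm h0 h2
    (hR.congr fun x y => by simp) ?_ ?_
  · intro b s' hb hI h6 hr _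
    have h0' : s'.reg 0 = n := (hr 0 (by decide)).trans h0
    have h2' : s'.reg 2 = 1 := (hr 2 (by decide)).trans h2
    have h4' : s'.reg 4 = k := (hr 4 (by decide)).trans h4
    have h5' : s'.reg 5 = a := (hr 5 (by decide)).trans h5
    have key : ∀ s'' : Store, s''.arr = s'.arr → ¬ (R a k ∧ R k ⟨b, hb⟩) →
        Represents s'' n fun x y =>
          R x y ∨ ((x < a ∨ x = a ∧ y.val < b + 1) ∧ R x k ∧ R k y) := by
      intro s'' ha hn x y
      rw [ha]
      refine (hI x y).trans ?_
      have : x = a → y.val = b → ¬ (R x k ∧ R k y) := by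
        rintro rfl hy
        rwa [show y = ⟨b, hb⟩ from Fin.ext hy]
      grind
    refine .seq (within_getEntry (by omega) h2' fun s₁ hx₁ ha₁ hr₁ => ?_)
    rw [h5', h0', h4'] at hx₁
    refine .branch (fun hne => ?_) (fun he => ?_)
    · rw [hx₁, hI a k] at hne
      have hak : R a k := by tauto
      have h0₁ : s₁.reg 0 = n := (hr₁ 0 (by decide)).trans h0'
      have h2₁ : s₁.reg 2 = 1 := (hr₁ 2 (by decide)).trans h2'
      have h4₁ : s₁.reg 4 = k := (hr₁ 4 (by decide)).trans h4'
      have h5₁ : s₁.reg 5 = a := (hr₁ 5 (by decide)).trans h5'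
      have h6₁ : s₁.reg 6 = b := (hr₁ 6 (by decide)).trans h6
      refine .seq (within_getEntry (by omega) h2₁ fun s₂ hx₂ ha₂ hr₂ => ?_)
      rw [h4₁, h0₁, h6₁, ha₁] at hx₂
      have hkb := hI k ⟨b, hb⟩
      refine .branch (fun hne => ?_) (fun he => ?_)
      · rw [hx₂, hkb] at hne
        have hkb' : R k ⟨b, hb⟩ := by tauto
        have h0₂ : s₂.reg 0 = n := (hr₂ 0 (by decide)).trans h0₁
        have h2₂ : s₂.reg 2 = 1 := (hr₂ 2 (by decide)).trans h2₁
        have h5₂ : s₂.reg 5 = a := (hr₂ 5 (by decide)).trans h5₁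
        have h6₂ : s₂.reg 6 = b := (hr₂ 6 (by decide)).trans h6₁
        refine within_setEntry (by omega) h2₂ fun s₃ ha₃ _ => ?_
        rw [h5₂, h0₂, h6₂, h2₂, ha₂, ha₁] at ha₃
        refine (hI.setEntry a ⟨b, hb⟩ ha₃).congr fun x y => ?_
        have : x = a → y.val = b → R x k ∧ R k y := by
          rintro rfl hy
          rw [show y = ⟨b, hb⟩ from Fin.ext hy]
          exact ⟨hak, hkb'⟩
        rw [Fin.ext_iff (a := y)]
        grind
      · rw [hx₂] at he
        refine .skip (key _ (ha₂.trans ha₁) fun h => ?_)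
        exact hkb.2 (Or.inl h.2) he
    · rw [hx₁] at he
      exact .skip (key _ ha₁ fun h => (hI a k).2 (Or.inl h.1) he)
  · intro s' hI _ _
    exact hI.congr fun x y => by simp [y.2, le_iff_lt_or_eq]

/-- Stage `k` admits `k` as an intermediate vertex. -/
theorem within_transitiveClosure_stage {m n : ℕ} {s : Store} {R : Fin n → Fin n → Prop} (k : Fin n)
    (hm : n ≤ m) (h0 : s.reg 0 = n) (h2 : s.reg 2 = 1) (h4 : s.reg 4 = k)
    (hR : Represents s n R) :
    Within m (forLoop 5 0 (forLoop 6 0 (.seq (getEntry 11 0 5 0 4) (.branch 11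
      (.seq (getEntry 11 0 4 0 6) (.branch 11 (setEntry 0 5 0 6 2) .skip)) .skip)))) s
      fun s' => Represents s' n fun x y => R x y ∨ (R x k ∧ R k y) := by
  refine within_forLoop (fun a s' => Represents s' n fun x y =>
    R x y ∨ (x.val < a ∧ R x k ∧ R k y)) hm h0 h2 (hR.congr fun x y => by simp) ?_ ?_
  · intro a s' ha hI h5 hr _
    refine (within_transitiveClosure_row k ⟨a, ha⟩ hm ((hr 0 (by decide)).trans h0)
      ((hr 2 (by decide)).trans h2) ((hr 4 (by decide)).trans h4) h5
      (hI.congr fun x y => by rw [Fin.lt_def])).imp fun s'' h => ?_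
    exact h.congr fun x y => by rw [Fin.le_def, Nat.lt_succ_iff]
  · intro s' hI _ _
    exact hI.congr fun x y => by simp [x.2]

/-- After the stages `0, …, k - 1`, the represented relation `M` lies between `R` and its
transitive closure, and `M x z`, `M z y` imply `M x y` for `z < k`. -/
theorem within_transitiveClosure {m n : ℕ} {s : Store} {Q : Store → Prop}
    {R : Fin n → Fin n → Prop} (hm : n ≤ m) (h0 : s.reg 0 = n) (h2 : s.reg 2 = 1)
    (hR : Represents s n R)
    (hQ : ∀ s', Represents s' n (Relation.TransGen R) →
      (∀ y ∉ transitiveClosure.regs, s'.reg y = s.reg y) →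
      (∀ a ∉ transitiveClosure.arrs, s'.arr a = s.arr a) → Q s') :
    Within m transitiveClosure s Q := by
  suffices h : Within m transitiveClosure s fun s' => Represents s' n (Relation.TransGen R) from
    h.framed.imp fun s' h => hQ s' h.1 h.2.1 h.2.2
  refine within_forLoop (fun k s' => ∃ M : Fin n → Fin n → Prop, Represents s' n M ∧
    (∀ x y, R x y → M x y) ∧ (∀ x y, M x y → Relation.TransGen R x y) ∧
    ∀ z : Fin n, z.val < k → ∀ x y, M x z → M z y → M x y) hm h0 h2
    ⟨R, hR, fun _ _ h => h, fun _ _ h => .single h, by simp⟩ ?_ ?_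
  · rintro k s' hk ⟨M, hM, hRM, hMR, hclosed⟩ h4 hr _
    refine (within_transitiveClosure_stage ⟨k, hk⟩ hm ((hr 0 (by decide)).trans h0)
      ((hr 2 (by decide)).trans h2) h4 hM).imp fun s'' h => ?_
    refine ⟨_, h, fun x y hxy => Or.inl (hRM x y hxy), ?_, ?_⟩
    · rintro x y (hxy | ⟨hxk, hky⟩)
      · exact hMR x y hxy
      · exact (hMR _ _ hxk).trans (hMR _ _ hky)
    · intro z hz x y hxz hzy
      rcases Nat.lt_succ_iff_lt_or_eq.1 hz with hz | hz
      · have := hclosed z hz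
        rcases hxz with hxz | ⟨hxk, hkz⟩ <;> rcases hzy with hzy | ⟨hzk, hky⟩
        · exact Or.inl (this _ _ hxz hzy)
        · exact Or.inr ⟨this _ _ hxz hzk, hky⟩
        · exact Or.inr ⟨hxk, this _ _ hkz hzy⟩
        · exact Or.inr ⟨hxk, hky⟩
      · obtain rfl : z = ⟨k, hk⟩ := Fin.ext hz
        refine Or.inr ⟨?_, ?_⟩
        · exact hxz.elim id fun h => h.1
        · exact hzy.elim id fun h => h.2
  · rintro s' ⟨M, hM, hRM, hMR, hclosed⟩ _ _
    refine hM.congr fun x y => ⟨hMR x y, fun h => ?_⟩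
    induction h with
    | single h => exact hRM _ _ h
    | tail _ h ih => exact hclosed _ (Fin.is_lt _) _ _ ih (hRM _ _ h)

end RAM

/-! ### Enumerating the non-top-linked components -/

/-- The vertex `u` is the least vertex of a non-top-linked component. -/
def Digraph.IsLeader {n : ℕ} (D : Digraph (Fin n)) (u : Fin n) : Prop :=
  ∀ v, D.HasPath v u → D.HasPath u v ∧ u ≤ v

theorem Digraph.IsLeader.isSource {n : ℕ} {D : Digraph (Fin n)} {u : Fin n} (h : D.IsLeader u) :
    D.IsSource u :=
  fun v hv => (h v hv).1

open Classical in
/-- The number of leaders less than `x`. -/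
noncomputable def Digraph.leaderCount {n : ℕ} (D : Digraph (Fin n)) (x : ℕ) : ℕ :=
  Nat.count (fun y => ∃ h : y < n, D.IsLeader ⟨y, h⟩) x

open Classical in
theorem Digraph.leaderCount_succ {n : ℕ} (D : Digraph (Fin n)) (u : Fin n) :
    D.leaderCount (u + 1) = D.leaderCount u + if D.IsLeader u then 1 else 0 := by
  rw [leaderCount, Nat.count_succ]
  simp [leaderCount]

/-- The non-top-linked components are enumerated in the order of their least vertices. -/
theorem exists_enumeration_of_leaders {n : ℕ} (A : StructMatrix (Fin n) (Fin n)) :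
    ∃ N : Fin ((stateDigraph A).leaderCount n) ≃ NonTopLinkedSCC A,
      ∀ i : Fin _, ∃ u : Fin n, (stateDigraph A).IsLeader u ∧ (stateDigraph A).leaderCount u = i ∧
        (N i).val = {v | (stateDigraph A).HasPath v u} := by
  classical
  set D := stateDigraph A with hD
  have hlt : ∀ u : Fin n, D.IsLeader u → D.leaderCount u < D.leaderCount n := fun u hu =>
    Nat.count_strict_mono (p := fun y => ∃ h : y < n, D.IsLeader ⟨y, h⟩) ⟨u.2, hu⟩ u.2
  let φ : {u // D.IsLeader u} → NonTopLinkedSCC A :=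
    fun u => ⟨{v | D.HasPath v u}, u.2.isSource.isNonTopLinkedSCC⟩
  let ψ : {u // D.IsLeader u} → Fin (D.leaderCount n) :=
    fun u => ⟨D.leaderCount u, hlt u u.2⟩
  have hφ : Function.Bijective φ := by
    constructor
    · intro u u' h
      have h' : {v | D.HasPath v u} = {v | D.HasPath v u'} := congrArg Subtype.val h
      have h1 : u.1 ∈ {v | D.HasPath v u'} := h' ▸ (.refl : D.HasPath u u)
      have h2 : u'.1 ∈ {v | D.HasPath v u} := h' ▸ (.refl : D.HasPath u' u')
      exact Subtype.ext (le_antisymm (u.2 _ h2).2 (u'.2 _ h1).2)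
    · rintro ⟨S, hS⟩
      obtain ⟨u, hu, hmin⟩ := Set.exists_min_image S id (Set.toFinite S) hS.1.1.1
      exact ⟨⟨u, fun v hv => ⟨hS.isSource hu v hv, hmin v (hS.mem_of_hasPath hu hv)⟩⟩,
        Subtype.ext (hS.eq_setOf_hasPath hu).symm⟩
  have hψ : Function.Bijective ψ := by
    constructor
    · intro u u' h
      have h' : D.leaderCount u = D.leaderCount u' := congrArg Fin.val h
      exact Subtype.ext (Fin.ext (Nat.count_injective
        (p := fun y => ∃ h : y < n, D.IsLeader ⟨y, h⟩) ⟨u.1.2, u.2⟩ ⟨u'.1.2, u'.2⟩ h'))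
    · have key : ∀ x ≤ n, ∀ i < D.leaderCount x,
          ∃ u : Fin n, D.IsLeader u ∧ D.leaderCount u = i := by
        intro x
        induction x with
        | zero => simp [Digraph.leaderCount]
        | succ x ih =>
          intro hx i hi
          rw [show x + 1 = (⟨x, hx⟩ : Fin n).val + 1 from rfl, D.leaderCount_succ] at hi
          by_cases hix : i < D.leaderCount x
          · exact ih (by omega) i hix
          · split_ifs at hi with hlead
            · exact ⟨⟨x, hx⟩, hlead, by simp only at hi ⊢; omega⟩
            · exact absurd hi hix
      intro i
      obtain ⟨u, hu, hui⟩ := key n le_rfl i i.2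
      exact ⟨⟨u, hu⟩, Fin.ext hui⟩
  refine ⟨(Equiv.ofBijective ψ hψ).symm.trans (Equiv.ofBijective φ hφ), fun i => ?_⟩
  obtain ⟨u, rfl⟩ := hψ.2 i
  refine ⟨u, u.2, rfl, ?_⟩
  rw [Equiv.trans_apply, Equiv.ofBijective_symm_apply_apply]
  rfl

/-! ### The reduction -/

namespace RAM

variable {n p : ℕ}

/-- Append to the matrix in the array `2` the row of the ancestors of the vertex in register `4`:
its entry `j` tells whether the input `j` acts on an ancestor. -/
def writeRow : Program :=
  forLoop 5 1 (.seq (.const 7 0) (.seq (forLoop 6 0 (.seq (getEntry 11 0 4 0 6) (.branch 11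
    (.seq (getEntry 11 1 6 1 5) (.branch 11 (.const 7 1) .skip)) .skip))) (setEntry 2 3 1 5 7)))

/-- Put into register `7` the truth value of the statement that the vertex in register `4` is a
leader. -/
def testLeader : Program :=
  .seq (.const 7 1) (forLoop 5 0 (.seq (getEntry 11 0 4 0 5) (.branch 11
    (.seq (getEntry 11 0 5 0 4) (.seq (.branch 11 .skip (.const 7 0))
      (.seq (.sub 11 4 5) (.branch 11 (.const 7 0) .skip)))) .skip)))

/-- The reduction. Register `3` counts the leaders met so far. Each vertex writes its row, and
the row of a vertex that is not a leader gets overwritten. -/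
def reduction : Program :=
  .seq (.const 2 1) (.seq reflexiveClosure (.seq transitiveClosure (.seq (.const 3 0)
    (.seq (forLoop 4 0 (.seq writeRow (.seq testLeader (.add 3 3 7))))
      (.seq (.const 10 0) (.add 0 3 10))))))

/-- The memory during the main loop: the sizes are in registers `0` and `1`, the array `0` holds
the reachability relation (the ancestors of a vertex form its row), and the array `1` holds `B`. -/
structure Ready (A : StructMatrix (Fin n) (Fin n)) (B : StructMatrix (Fin n) (Fin p))
    (s : Store) : Prop where
  reg_zero : s.reg 0 = n
  reg_one : s.reg 1 = p
  reg_two : s.reg 2 = 1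
  reach : Represents s n fun a b => (stateDigraph A).HasPath b a
  input : ∀ (r : Fin n) (j : Fin p), s.arr 1 (r * p + j) ≠ 0 ↔ B r j = true

theorem Ready.of_frame {A : StructMatrix (Fin n) (Fin n)} {B : StructMatrix (Fin n) (Fin p)}
    {s s' : Store} (h : Ready A B s) (h0 : s'.reg 0 = s.reg 0) (h1 : s'.reg 1 = s.reg 1)
    (h2 : s'.reg 2 = s.reg 2) (ha0 : s'.arr 0 = s.arr 0) (ha1 : s'.arr 1 = s.arr 1) :
    Ready A B s' :=
  ⟨h0.trans h.reg_zero, h1.trans h.reg_one, h2.trans h.reg_two,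
    fun a b => by rw [ha0]; exact h.reach a b, fun r j => by rw [ha1]; exact h.input r j⟩

open Classical in
theorem within_writeRow {A : StructMatrix (Fin n) (Fin n)} {B : StructMatrix (Fin n) (Fin p)}
    {m : ℕ} {s : Store} (hnm : n ≤ m) (hpm : p ≤ m) (hs : Ready A B s) (u : Fin n)
    (h4 : s.reg 4 = u) (h3 : s.reg 3 ≤ m) :
    Within m writeRow s fun s' =>
      (∀ j : Fin p, s'.arr 2 (s.reg 3 * p + j) =
        if ∃ r, B r j = true ∧ (stateDigraph A).HasPath r u then 1 else 0) ∧
      ∀ y < s.reg 3 * p, s'.arr 2 y = s.arr 2 y := by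
  refine within_forLoop (fun k s' => (∀ j : Fin p, j.val < k → s'.arr 2 (s.reg 3 * p + j) =
        if ∃ r, B r j = true ∧ (stateDigraph A).HasPath r u then 1 else 0) ∧
      ∀ y < s.reg 3 * p, s'.arr 2 y = s.arr 2 y) hpm hs.reg_one hs.reg_two
      ⟨by simp, fun _ _ => rfl⟩ ?_ (fun s' hI _ _ => ⟨fun j => hI.1 j j.2, hI.2⟩)
  intro j s₁ hj hI h5 hr₁ ha₁
  have hs₁ : Ready A B s₁ := hs.of_frame (hr₁ 0 (by decide)) (hr₁ 1 (by decide))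
    (hr₁ 2 (by decide)) (ha₁ 0 (by decide)) (ha₁ 1 (by decide))
  refine .seq (.const (.seq (Within.imp (Within.framed (within_forLoop (Q := fun s' => s'.reg 7 =
    if ∃ r, B r ⟨j, hj⟩ = true ∧ (stateDigraph A).HasPath r u then 1 else 0)
    (fun k s' => s'.reg 7 =
    if ∃ r : Fin n, r.val < k ∧ B r ⟨j, hj⟩ = true ∧ (stateDigraph A).HasPath r u then 1 else 0)
    hnm hs₁.reg_zero hs₁.reg_two ?_ ?_ ?_)) ?_)))
  · simp [Store.reg_setReg]
  · intro k s₂ hk hI₂ h6 hr₂ ha₂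
    have hs₂ : Ready A B s₂ := hs₁.of_frame (hr₂ 0 (by decide)) (hr₂ 1 (by decide))
      (hr₂ 2 (by decide)) (ha₂ 0 (by decide)) (ha₂ 1 (by decide))
    have h4₂ : s₂.reg 4 = u :=
      ((hr₂ 4 (by decide)).trans (hr₁ 4 (by decide))).trans h4
    have h5₂ : s₂.reg 5 = j := (hr₂ 5 (by decide)).trans h5
    have hsplit : (∃ r : Fin n, r.val < k + 1 ∧ B r ⟨j, hj⟩ = true ∧
        (stateDigraph A).HasPath r u) ↔ (∃ r : Fin n, r.val < k ∧ B r ⟨j, hj⟩ = true ∧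
        (stateDigraph A).HasPath r u) ∨ (B ⟨k, hk⟩ ⟨j, hj⟩ = true ∧
        (stateDigraph A).HasPath ⟨k, hk⟩ u) := by
      constructor
      · rintro ⟨r, hr, h⟩
        rcases Nat.lt_succ_iff_lt_or_eq.1 hr with hr | hr
        · exact Or.inl ⟨r, hr, h⟩
        · obtain rfl : r = ⟨k, hk⟩ := Fin.ext hr
          exact Or.inr h
      · rintro (⟨r, hr, h⟩ | h)
        · exact ⟨r, by omega, h⟩
        · exact ⟨⟨k, hk⟩, Nat.lt_succ_self k, h⟩
    refine .seq (within_getEntry (by omega) hs₂.reg_two fun s₃ hx₃ ha₃ hr₃ => ?_)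
    rw [h4₂, hs₂.reg_zero, h6] at hx₃
    have hreach := hs₂.reach u ⟨k, hk⟩
    refine .branch (fun hne => ?_) (fun he => .skip ?_)
    · rw [hx₃, hreach] at hne
      have hs₃ : Ready A B s₃ := hs₂.of_frame (hr₃ 0 (by decide)) (hr₃ 1 (by decide))
        (hr₃ 2 (by decide)) (by rw [ha₃]) (by rw [ha₃])
      have h5₃ : s₃.reg 5 = j := (hr₃ 5 (by decide)).trans h5₂
      have h6₃ : s₃.reg 6 = k := (hr₃ 6 (by decide)).trans h6
      refine .seq (within_getEntry (by omega) hs₃.reg_two fun s₄ hx₄ ha₄ hr₄ => ?_)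
      rw [h6₃, hs₃.reg_one, h5₃] at hx₄
      have hinput := hs₃.input ⟨k, hk⟩ ⟨j, hj⟩
      refine .branch (fun hne' => .const ?_) (fun he => .skip ?_)
      · rw [hx₄, hinput] at hne'
        simp only [Store.reg_setReg, hsplit]
        simp [hne, hne']
      · rw [hx₄] at he
        have hB : ¬ B ⟨k, hk⟩ ⟨j, hj⟩ = true := fun h => hinput.2 h he
        simp only [Store.reg_setReg, hsplit, hB]
        simpa using ((hr₄ 7 (by decide)).trans (hr₃ 7 (by decide))).trans hI₂
    · rw [hx₃] at he
      have hP : ¬ (stateDigraph A).HasPath ⟨k, hk⟩ u := fun h => hreach.2 h he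
      simp only [Store.reg_setReg, hsplit, hP, and_false, or_false]
      simpa using (hr₃ 7 (by decide)).trans hI₂
  · intro s₂ hI₂ _ _
    rw [hI₂]
    simp
  · rintro s₂ ⟨h7, hr₂, ha₂⟩
    have h3₂ : s₂.reg 3 = s.reg 3 := (hr₂ 3 (by decide)).trans (hr₁ 3 (by decide))
    have h5₂ : s₂.reg 5 = j := (hr₂ 5 (by decide)).trans h5
    have h1₂ : s₂.reg 1 = p := (hr₂ 1 (by decide)).trans hs₁.reg_one
    have h2₂ : s₂.reg 2 = 1 := (hr₂ 2 (by decide)).trans hs₁.reg_two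
    have ha : s₂.arr 2 = s₁.arr 2 := ha₂ 2 (by decide)
    refine within_setEntry (by omega) h2₂ fun s₃ ha₃ _ => ?_
    rw [h3₂, h1₂, h5₂, h7] at ha₃
    refine ⟨fun j' hj' => ?_, fun y hy => ?_⟩
    · rw [Store.arr_setReg, Store.arr_setReg, ha₃]
      rcases Nat.lt_succ_iff_lt_or_eq.1 hj' with hj' | hj'
      · rw [if_neg (by omega), ha]
        exact hI.1 j' hj'
      · obtain rfl : j' = ⟨j, hj⟩ := Fin.ext hj'
        rw [if_pos ⟨rfl, rfl⟩]
    · rw [Store.arr_setReg, Store.arr_setReg, ha₃, if_neg (by omega), ha]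
      exact hI.2 y hy

open Classical in
theorem within_testLeader {A : StructMatrix (Fin n) (Fin n)} {B : StructMatrix (Fin n) (Fin p)}
    {m : ℕ} {s : Store} (hnm : n ≤ m) (hs : Ready A B s) (u : Fin n) (h4 : s.reg 4 = u) :
    Within m testLeader s fun s' =>
      s'.reg 7 = if (stateDigraph A).IsLeader u then 1 else 0 := by
  set D := stateDigraph A with hD
  refine .seq (.const (within_forLoop (fun k s' => s'.reg 7 =
    if ∀ v : Fin n, v.val < k → D.HasPath v u → D.HasPath u v ∧ u ≤ v then 1 else 0)
    hnm hs.reg_zero hs.reg_two ?_ ?_ ?_))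
  · simp [Store.reg_setReg]
  · intro k s₂ hk hI h5 hr₂ ha₂
    have hs₂ : Ready A B s₂ := hs.of_frame (hr₂ 0 (by decide)) (hr₂ 1 (by decide))
      (hr₂ 2 (by decide)) (ha₂ 0 (by decide)) (ha₂ 1 (by decide))
    have h4₂ : s₂.reg 4 = u := (hr₂ 4 (by decide)).trans h4
    have hsplit : (∀ v : Fin n, v.val < k + 1 → D.HasPath v u → D.HasPath u v ∧ u ≤ v) ↔
        (∀ v : Fin n, v.val < k → D.HasPath v u → D.HasPath u v ∧ u ≤ v) ∧
        (D.HasPath ⟨k, hk⟩ u → D.HasPath u ⟨k, hk⟩ ∧ u.val ≤ k) := by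
      constructor
      · exact fun h => ⟨fun v hv => h v (by omega), h ⟨k, hk⟩ (Nat.lt_succ_self k)⟩
      · rintro ⟨h, h'⟩ v hv
        rcases Nat.lt_succ_iff_lt_or_eq.1 hv with hv | hv
        · exact h v hv
        · obtain rfl : v = ⟨k, hk⟩ := Fin.ext hv
          exact h'
    refine .seq (within_getEntry (by omega) hs₂.reg_two fun s₃ hx₃ ha₃ hr₃ => ?_)
    rw [h4₂, hs₂.reg_zero, h5] at hx₃
    have hto : s₂.arr 0 (u * n + k) ≠ 0 ↔ D.HasPath ⟨k, hk⟩ u := hs₂.reach u ⟨k, hk⟩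
    have hfrom : s₂.arr 0 (k * n + u) ≠ 0 ↔ D.HasPath u ⟨k, hk⟩ := hs₂.reach ⟨k, hk⟩ u
    refine .branch (fun hne => ?_) (fun he => .skip ?_)
    · rw [hx₃, hto] at hne
      have h0₃ : s₃.reg 0 = n := (hr₃ 0 (by decide)).trans hs₂.reg_zero
      have h2₃ : s₃.reg 2 = 1 := (hr₃ 2 (by decide)).trans hs₂.reg_two
      have h4₃ : s₃.reg 4 = u := (hr₃ 4 (by decide)).trans h4₂
      have h5₃ : s₃.reg 5 = k := (hr₃ 5 (by decide)).trans h5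
      have h7₃ := (hr₃ 7 (by decide)).trans hI
      refine .seq (within_getEntry (by omega) h2₃ fun s₄ hx₄ _ hr₄ => ?_)
      rw [h5₃, h0₃, h4₃, ha₃] at hx₄
      have h4₄ : s₄.reg 4 = u := (hr₄ 4 (by decide)).trans h4₃
      have h5₄ : s₄.reg 5 = k := (hr₄ 5 (by decide)).trans h5₃
      have h7₄ := (hr₄ 7 (by decide)).trans h7₃
      refine .seq (.branch (fun hne' => .skip ?_) fun he => .const ?_)
      · rw [hx₄, hfrom] at hne'
        refine .seq (.sub (.branch (fun hlt => .const ?_) fun hge => .skip ?_))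
        · simp only [Store.reg_setReg, if_true, h4₄, h5₄] at hlt
          have : ¬ u.val ≤ k := by omega
          simp only [Store.reg_setReg, hsplit]
          simp [hne, this]
        · simp only [Store.reg_setReg, if_true, h4₄, h5₄] at hge
          have : u.val ≤ k := by omega
          simp only [Store.reg_setReg, hsplit, hne, hne', this, implies_true, and_true]
          simpa using h7₄
      · rw [hx₄] at he
        have hP : ¬ D.HasPath u ⟨k, hk⟩ := fun h => hfrom.2 h he
        refine .seq (.sub (.branch (fun _ => .const ?_) fun _ => .skip ?_)) <;>
        simp only [Store.reg_setReg, hsplit] <;> simp [hne, hP]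
    · rw [hx₃] at he
      have hP : ¬ D.HasPath ⟨k, hk⟩ u := fun h => hto.2 h he
      simp only [Store.reg_setReg, hsplit, hP, false_implies, and_true]
      simpa using (hr₃ 7 (by decide)).trans hI
  · intro s' hI _ _
    rw [hI]
    exact if_congr (by simp [Digraph.IsLeader]) rfl rfl

open Classical in
/-- The rows of the leaders met so far are in place. The next row is written behind them, since
the number of the row of a leader is the number of the leaders before it. -/
theorem within_mainLoop {A : StructMatrix (Fin n) (Fin n)} {B : StructMatrix (Fin n) (Fin p)}
    {m : ℕ} {s : Store} (hnm : n ≤ m) (hpm : p ≤ m) (hs : Ready A B s) (h3 : s.reg 3 = 0) :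
    Within m (forLoop 4 0 (.seq writeRow (.seq testLeader (.add 3 3 7)))) s fun s' =>
      s'.reg 3 = (stateDigraph A).leaderCount n ∧
      ∀ u : Fin n, (stateDigraph A).IsLeader u → ∀ j : Fin p,
        s'.arr 2 ((stateDigraph A).leaderCount u * p + j) =
          if ∃ r, B r j = true ∧ (stateDigraph A).HasPath r u then 1 else 0 := by
  set D := stateDigraph A with hD
  refine within_forLoop (fun k s' => s'.reg 3 = D.leaderCount k ∧
      ∀ u : Fin n, u.val < k → D.IsLeader u → ∀ j : Fin p,
        s'.arr 2 (D.leaderCount u * p + j) =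
          if ∃ r, B r j = true ∧ D.HasPath r u then 1 else 0) hnm hs.reg_zero hs.reg_two
      ⟨by simp [Store.reg_setReg, h3, Digraph.leaderCount], by simp⟩ ?_
      (fun s' hI _ _ => ⟨hI.1, fun u => hI.2 u u.2⟩)
  rintro k s₁ hk ⟨h3₁, hI⟩ h4 hr₁ ha₁
  have hs₁ : Ready A B s₁ := hs.of_frame (hr₁ 0 (by decide)) (hr₁ 1 (by decide))
    (hr₁ 2 (by decide)) (ha₁ 0 (by decide)) (ha₁ 1 (by decide))
  have hle : D.leaderCount k ≤ k := Nat.count_le _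
  refine .seq ((within_writeRow hnm hpm hs₁ ⟨k, hk⟩ h4 (by omega)).framed.imp ?_)
  rintro s₂ ⟨⟨hrow, hold⟩, hr₂, ha₂⟩
  have hs₂ : Ready A B s₂ := hs₁.of_frame (hr₂ 0 (by decide)) (hr₂ 1 (by decide))
    (hr₂ 2 (by decide)) (ha₂ 0 (by decide)) (ha₂ 1 (by decide))
  refine .seq ((within_testLeader hnm hs₂ ⟨k, hk⟩ ((hr₂ 4 (by decide)).trans h4)).framed.imp ?_)
  rintro s₃ ⟨h7, hr₃, ha₃⟩
  have h3₃ : s₃.reg 3 = D.leaderCount k :=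
    ((hr₃ 3 (by decide)).trans (hr₂ 3 (by decide))).trans h3₁
  have ha : s₃.arr 2 = s₂.arr 2 := ha₃ 2 (by decide)
  refine .add ⟨?_, fun u hu hlead j => ?_⟩
  · simp only [Store.reg_setReg]
    simp only [h3₃, h7]
    exact (D.leaderCount_succ ⟨k, hk⟩).symm
  · simp only [Store.arr_setReg, ha]
    rcases Nat.lt_succ_iff_lt_or_eq.1 hu with hu | hu
    · have hlt : D.leaderCount u < D.leaderCount k :=
        Nat.count_strict_mono (p := fun y => ∃ h : y < n, D.IsLeader ⟨y, h⟩) ⟨u.2, hlead⟩ hu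
      rw [hold, hI u hu hlead j]
      calc D.leaderCount u * p + j < D.leaderCount u * p + p := by omega
        _ = (D.leaderCount u + 1) * p := by ring
        _ ≤ s₁.reg 3 * p := by rw [h3₁]; exact Nat.mul_le_mul_right p hlt
    · obtain rfl : u = ⟨k, hk⟩ := Fin.ext hu
      rw [← hrow j, h3₁]

theorem rowMajor_ne_zero_iff {m : ℕ} (M : StructMatrix (Fin m) (Fin p)) (i : Fin m) (j : Fin p) :
    rowMajor M (i * p + j) ≠ 0 ↔ M i j = true := by
  rw [rowMajor]
  split_ifs with h
  · obtain ⟨i', j', hij, hM⟩ := h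
    rw [entry_inj j.2 j'.2, Fin.val_inj, Fin.val_inj] at hij
    simp [hij, hM]
  · push Not at h
    simp [h i j rfl]

theorem exists_runs_reduction (A : StructMatrix (Fin n) (Fin n))
    (B : StructMatrix (Fin n) (Fin p)) :
    ∃ (k : ℕ) (N : Fin k ≃ NonTopLinkedSCC A) (t : ℕ) (s : Store),
      Runs reduction (minCISInput A B) t s ∧ t ≤ reduction.cost.eval (n + p) ∧
      HoldsSetCoverInstance s (coverSet A B N) := by
  classical
  obtain ⟨N, hN⟩ := exists_enumeration_of_leaders A
  refine ⟨_, N, ?_⟩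
  set D := stateDigraph A with hD
  have hnm : n ≤ n + p := Nat.le_add_right n p
  have hpm : p ≤ n + p := Nat.le_add_left p n
  change Within (n + p) reduction (minCISInput A B) fun s => HoldsSetCoverInstance s _
  refine .seq (.const (.seq (within_reflexiveClosure (n := n) (R := fun a b => D.Adj b a) hnm
    ?_ ?_ ?_ fun s₁ hR₁ hr₁ ha₁ => ?_)))
  · simp [Store.reg_setReg, minCISInput]
  · simp [Store.reg_setReg]
  · intro a b
    exact rowMajor_ne_zero_iff A a b
  have h0₁ : s₁.reg 0 = n := (hr₁ 0 (by decide)).trans (by simp [Store.reg_setReg, minCISInput])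
  have h1₁ : s₁.reg 1 = p := (hr₁ 1 (by decide)).trans (by simp [Store.reg_setReg, minCISInput])
  have h2₁ : s₁.reg 2 = 1 := (hr₁ 2 (by decide)).trans (by simp [Store.reg_setReg])
  refine .seq (within_transitiveClosure hnm h0₁ h2₁ hR₁ fun s₂ hR₂ hr₂ ha₂ => ?_)
  have hs₂ : Ready A B (s₂.setReg 3 0) := by
    refine ⟨(hr₂ 0 (by decide)).trans h0₁, (hr₂ 1 (by decide)).trans h1₁,
      (hr₂ 2 (by decide)).trans h2₁, hR₂.congr fun a b => ?_, fun r j => ?_⟩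
    · -- paths are followed backwards here, since the row of a vertex holds its ancestors
      constructor
      · intro h
        induction h with
        | single h =>
          rcases h with h | rfl
          · exact Relation.ReflTransGen.single h
          · exact .refl
        | tail _ h ih =>
          rcases h with h | rfl
          · exact Relation.ReflTransGen.head h ih
          · exact ih
      · intro h
        induction h using Relation.ReflTransGen.head_induction_on with
        | refl => exact .single (Or.inr rfl)
        | head h _ ih => exact .tail ih (Or.inl h)
    · rw [Store.arr_setReg, ha₂ 1 (by decide), ha₁ 1 (by decide)]
      exact rowMajor_ne_zero_iff B r j
  refine .seq (.const (.seq ((within_mainLoop hnm hpm hs₂ rfl).framed.imp ?_)))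
  rintro s₃ ⟨⟨h3, hrows⟩, hr₃, -⟩
  refine .seq (.const (.add ⟨?_, ?_, fun i j => ?_⟩))
  · simp [Store.reg_setReg, h3]
  · simp only [Store.reg_setReg]
    simpa using (hr₃ 1 (by decide)).trans hs₂.reg_one
  · obtain ⟨u, hu, hui, hNi⟩ := hN i
    have := hrows u hu j
    rw [hui] at this
    rw [Store.arr_setReg, Store.arr_setReg, this, coverSet, Set.mem_ofPred_eq, hNi]
    exact ⟨fun h => if_pos h, fun h => if_neg h⟩

end RAM

theorem mainTheorem3 :
    -- the reduction is computed in polynomial time, by one program for all instances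
    (∃ (P : RAM.Program) (q : Polynomial ℕ), ∀ (n p : ℕ)
      (A : StructMatrix (Fin n) (Fin n)) (B : StructMatrix (Fin n) (Fin p)),
      HasPerfectStateMatching A →
      ∃ (k : ℕ) (N : Fin k ≃ NonTopLinkedSCC A) (t : ℕ) (s : RAM.Store),
        RAM.Runs P (minCISInput A B) t s ∧ t ≤ q.eval (n + p) ∧
        HoldsSetCoverInstance s (coverSet A B N)) ∧
    -- the reduction is correct, for every enumeration of the non-top-linked components
    (∀ (n p : ℕ) (A : StructMatrix (Fin n) (Fin n)) (B : StructMatrix (Fin n) (Fin p)),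
      HasPerfectStateMatching A →
      ∀ (k : ℕ) (N : Fin k ≃ NonTopLinkedSCC A),
        (∀ J : Finset (Fin p), IsInputSelection A B J ↔ IsSetCover (coverSet A B N) J) ∧
        (∀ J : Finset (Fin p), IsMinInputSelection A B J ↔ IsMinSetCover (coverSet A B N) J)) := by
  refine ⟨⟨RAM.reduction, RAM.reduction.cost, fun n p A B _ => RAM.exists_runs_reduction A B⟩,
    fun n p A B hA k N => ⟨isInputSelection_iff_isSetCover hA N,
      isMinInputSelection_iff_isMinSetCover hA N⟩⟩
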